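/- Let $a<c<b$ be real and let $q:[a,c)\cup(c,b]\to\mathbb R$ be continuous on $[a,c)$ and on $(c,b]$ with finite limits $q(c\mp0)$. Let $\alpha_{ij},\alpha'_{2j},\beta^{\pm}_{ij}$ ($i=1,2$, $j=0,1$) be real, with $(\alpha_{10},\alpha_{11})\neq(0,0)$. Consider the problem $$-y''+q(x)y=\lambda y\quad\text{on }[a,c)\cup(c,b],$$ $$\alpha_{10}y(a)+\alpha_{11}y'(a)=0,\qquad \alpha_{20}y(b)-\alpha_{21}y'(b)+\lambda\bigl(\alpha'_{20}y(b)-\alpha'_{21}y'(b)\bigr)=0,$$ $$\beta^-_{i1}y'(c-)+\beta^-_{i0}y(c-)+\beta^+_{i1}y'(c+)+\beta^+_{i0}y(c+)=0\qquad(i=1,2),$$ with complex spectral parameter $\lambda$; a number $\lambda\in\mathbb C$ is an eigenvalue if the problem has a solution $y$ that is not identically zero. Put $$\Delta_0=\alpha_{21}\alpha'_{20}-\alpha_{20}\alpha'_{21},$$ and let $\Delta_{kj}$ be the determinant of the $k$-th and $j$-th columns of $$A=\begin{pmatrix}\beta^-_{10}&\beta^-_{11}&\beta^+_{10}&\beta^+_{11}\\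 \beta^-_{20}&\beta^-_{21}&\beta^+_{20}&\beta^+_{21}\end{pmatrix}.$$ Assume $\Delta_0>0$, $\Delta_{12}>0$, $\Delta_{34}>0$ and $\Delta_{24}\neq0$. Then all eigenvalues are real, there are countably infinitely many of them, and they can be listed, each exactly once, as two sequences $\lambda_{n,1}=s_{n,1}^2$, $\lambda_{n,2}=s_{n,2}^2$ with $s_{n,1},s_{n,2}\in\mathbb C$, whose indices run over $n\ge0$ (except that in case (i) the first sequence runs over $n\ge1$), such that as $n\to\infty$: (i) if $\alpha'_{21}\ne0$ and $\alpha_{11}\ne0$, then $s_{n,1}=(n-2)\dfrac{\pi}{b-c}+O\bigl(\tfrac1n\bigr)$ and $s_{n,2}=\dfrac{n\pi}{a-c}+O\bigl(\tfrac1n\bigr)$; (ii) if $\alpha'_{21}\ne0$ and $\alpha_{11}=0$, then $s_{n,1}=(n-1)\dfrac{\pi}{b-c}+O\bigl(\tfrac1n\bigr)$ and $s_{n,2}=\bigl(n+\tfrac12\bigr)\dfrac{\pi}{a-c}+O\bigl(\tfrac1n\bigr)$; (iii) if $\alpha'_{21}=0$ and $\alpha_{11}\ne0$, then $s_{n,1}=\bigl(n+\tfrac12\bigr)\dfrac{\pi}{b-c}+O\bigl(\tfrac1n\bigr)$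 and $s_{n,2}=(n-1)\dfrac{\pi}{a-c}+O\bigl(\tfrac1n\bigr)$; (iv) if $\alpha'_{21}=0$ and $\alpha_{11}=0$, then $s_{n,1}=\bigl(n-\tfrac12\bigr)\dfrac{\pi}{b-c}+O\bigl(\tfrac1n\bigr)$ and $s_{n,2}=\bigl(n+\tfrac12\bigr)\dfrac{\pi}{a-c}+O\bigl(\tfrac1n\bigr)$. -/

import Mathlib

open Set Filter Topology Asymptotics

/-- The data of the boundary value problem with one transmission point `c`:
the equation `-y'' + q y = mu y` on `[a, c) ∪ (c, b]`, the coefficients of the two boundary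
conditions (`α'` is the part multiplied by the eigenparameter), and the coefficients of the two
transmission conditions (`m` for the left side `c-`, `p` for the right side `c+`). -/
structure TransmissionProblem where
  a : ℝ
  b : ℝ
  c : ℝ
  q : ℝ → ℝ
  α₁₀ : ℝ
  α₁₁ : ℝ
  α₂₀ : ℝ
  α₂₁ : ℝ
  α'₂₀ : ℝ
  α'₂₁ : ℝ
  βm₁₀ : ℝ
  βm₁₁ : ℝ
  βp₁₀ : ℝ
  βp₁₁ : ℝ
  βm₂₀ : ℝ
  βm₂₁ : ℝ
  βp₂₀ : ℝ
  βp₂₁ : ℝ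

namespace TransmissionProblem

/-- The punctured interval `[a, c) ∪ (c, b]`. -/
def dom (P : TransmissionProblem) : Set ℝ := Ico P.a P.c ∪ Ioc P.c P.b

/-- The matrix of the coefficients in the boundary condition at `b`. -/
def A₀ (P : TransmissionProblem) : Matrix (Fin 2) (Fin 2) ℝ :=
  !![P.α₂₁, P.α₂₀; P.α'₂₁, P.α'₂₀]

/-- The matrix of the coefficients of the transmission conditions. -/
def A (P : TransmissionProblem) : Matrix (Fin 2) (Fin 4) ℝ :=
  !![P.βm₁₀, P.βm₁₁, P.βp₁₀, P.βp₁₁; P.βm₂₀, P.βm₂₁, P.βp₂₀, P.βp₂₁]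

/-- The determinant of the columns `k` and `j` of `A`; columns are counted from `0` here. -/
def minor (P : TransmissionProblem) (k j : Fin 4) : ℝ := (P.A.submatrix id ![k, j]).det

def Δ₀ (P : TransmissionProblem) : ℝ := P.A₀.det
def Δ₁₂ (P : TransmissionProblem) : ℝ := P.minor 0 1
def Δ₃₄ (P : TransmissionProblem) : ℝ := P.minor 2 3
def Δ₂₄ (P : TransmissionProblem) : ℝ := P.minor 1 3

/-- `q` is continuous on `[a, c)` and on `(c, b]`, with finite limits at `c-` and `c+`. -/
def PotentialRegular (P : TransmissionProblem) : Prop :=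
  ContinuousOn P.q (Ico P.a P.c) ∧ ContinuousOn P.q (Ioc P.c P.b) ∧
    (∃ l : ℝ, Tendsto P.q (𝓝[<] P.c) (𝓝 l)) ∧ (∃ r : ℝ, Tendsto P.q (𝓝[>] P.c) (𝓝 r))

/-- `y`, with derivative `dy`, solves `-y'' + q y = mu y` on `[a, c) ∪ (c, b]`
(one-sided derivatives at `a` and `b`). -/
def SolvesEquation (P : TransmissionProblem) (mu : ℂ) (y dy : ℝ → ℂ) : Prop :=
  ∃ ddy : ℝ → ℂ, ∀ x ∈ P.dom,
    HasDerivWithinAt y (dy x) P.dom x ∧ HasDerivWithinAt dy (ddy x) P.dom x ∧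
      -ddy x + (P.q x : ℂ) * y x = mu * y x

/-- The boundary condition at `a`. -/
def BoundaryLeft (P : TransmissionProblem) (y dy : ℝ → ℂ) : Prop :=
  (P.α₁₀ : ℂ) * y P.a + P.α₁₁ * dy P.a = 0

/-- The eigenparameter-dependent boundary condition at `b`. -/
def BoundaryRight (P : TransmissionProblem) (mu : ℂ) (y dy : ℝ → ℂ) : Prop :=
  (P.α₂₀ : ℂ) * y P.b - P.α₂₁ * dy P.b + mu * (P.α'₂₀ * y P.b - P.α'₂₁ * dy P.b) = 0

/-- The one-sided limits `y(c±)`, `y'(c±)` exist and satisfy the two transmission conditions. -/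
def Transmission (P : TransmissionProblem) (y dy : ℝ → ℂ) : Prop :=
  ∃ ym dym yp dyp : ℂ,
    Tendsto y (𝓝[<] P.c) (𝓝 ym) ∧ Tendsto dy (𝓝[<] P.c) (𝓝 dym) ∧
    Tendsto y (𝓝[>] P.c) (𝓝 yp) ∧ Tendsto dy (𝓝[>] P.c) (𝓝 dyp) ∧
    P.βm₁₁ * dym + P.βm₁₀ * ym + P.βp₁₁ * dyp + P.βp₁₀ * yp = 0 ∧
    P.βm₂₁ * dym + P.βm₂₀ * ym + P.βp₂₁ * dyp + P.βp₂₀ * yp = 0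

/-- The complex number `mu` is an eigenvalue: the problem has a solution that does not vanish
identically on `[a, c) ∪ (c, b]`. -/
def IsEigenvalue (P : TransmissionProblem) (mu : ℂ) : Prop :=
  ∃ y dy : ℝ → ℂ, P.SolvesEquation mu y dy ∧ P.BoundaryLeft y dy ∧ P.BoundaryRight mu y dy ∧
    P.Transmission y dy ∧ ∃ x ∈ P.dom, y x ≠ 0

/-- The numbers `s₁ n ^ 2` with `n ≥ n₁` and `s₂ n ^ 2` with `n ≥ n₂` are exactly the eigenvalues,
each of them listed once. -/
def EigenvaluesListedBy (P : TransmissionProblem) (n₁ n₂ : ℕ) (s₁ s₂ : ℕ → ℂ) : Prop :=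
  {mu : ℂ | P.IsEigenvalue mu} = (fun n => s₁ n ^ 2) '' Ici n₁ ∪ (fun n => s₂ n ^ 2) '' Ici n₂ ∧
    InjOn (fun n => s₁ n ^ 2) (Ici n₁) ∧ InjOn (fun n => s₂ n ^ 2) (Ici n₂) ∧
    Disjoint ((fun n => s₁ n ^ 2) '' Ici n₁) ((fun n => s₂ n ^ 2) '' Ici n₂)

/-- `s n = t n + O(1/n)` as `n → ∞`. -/
def AsymptoticTo (s : ℕ → ℂ) (t : ℕ → ℝ) : Prop :=
  (fun n : ℕ => s n - (t n : ℂ)) =O[atTop] (fun n : ℕ => 1 / (n : ℝ))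

end TransmissionProblem

/-!
After reflecting `(c, b]` to `[-b, -c)`, both halves of the problem run towards the transmission
point. An eigenvalue is real by the Lagrange identity: `Im λ · Im (y' ȳ)` decreases on each half,
the sign of `Δ₀` controls it at `b`, and the transmission conditions with `Δ₁₂, Δ₃₄ > 0` couple the
two limits at `c` with a sign that leaves no room (`TransmissionProblem.IsHalfPair.im_eq_zero`).

For real `λ` let `Θᵢ` be the Prüfer angle at the transmission point of the solution on the `i`-th
half that satisfies the outer boundary condition, taken in the coordinates `(y' + Aᵢ y, κ y)`. With
`A₁ = Δ₁₄ / Δ₂₄`, `A₂ = -Δ₂₃ / Δ₂₄` and `κ² = Δ₁₂ Δ₃₄ / Δ₂₄²`, the Plücker relation between the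
minors turns the characteristic determinant into a non-zero multiple of `cos (Θ₁ + Θ₂)`
(`TransmissionProblem.isEigenvalue_iff_cos_eq_zero`). Both angles are continuous and strictly
increasing in `λ` (`IsPrueferAngle.lt_of_lt`; the initial angle at `b` rotates in the right
direction because `Δ₀ > 0`) and tend to `0` as `λ → -∞` (`IsPrueferAngle.le_of_barrier`). Hence the
eigenvalues form one sequence `μ k`, `k ≥ 0`, where `Θ₁ + Θ₂ = (k + 1/2) π` at `μ k`
(`IsStaircase.exists_seq`).

For the asymptotics put `λ = s²`. The angle `ψ` of `(y', s y)` satisfies `ψ' = s - (Q / s) sin² ψ`,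
so it is the initial phase plus `s` times the length of the interval, up to `O(1/s)`. It stays
within `π / 2` of `Θ`, and passing to `Θ` rescales by a factor of order `s`, so `Θ` is a smoothed
staircase that climbs from `n π + π / 4` to `n π + 3 π / 4` while `ψ` is within `O(1/s)` of
`(n + 1/2) π` (`IsAngleFamily.exists_phase_bound`). Comparing the sum of two such staircases with
`(k + 1/2) π` shows that `√(μ k)` is within `O(1/s)` of the `k`-th term of the increasing merge of
the two arithmetic progressions on which the phases are half-integer multiples of `π`, and the ranks
of the terms in that merge split `μ` into the two required sequences (`IsStaircase.exists_split`).
-/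

/-! ### Prüfer angles -/

/-- The right-hand side of the Prüfer equation of the trace-free planar system
`u' = m u + p w`, `w' = -r u - m w`: the angle of `(w, u)` turns at this speed. -/
noncomputable def prueferSpeed (p m r θ : ℝ) : ℝ :=
  p * Real.cos θ ^ 2 + 2 * m * (Real.sin θ * Real.cos θ) + r * Real.sin θ ^ 2

/-- `Θ` solves the Prüfer equation with coefficients `p`, `m`, `r` on `[x₀, x₁]`. It is a
continuous function on the whole line, differentiable in the two-sided sense at the endpoints. -/
structure IsPrueferAngle (p m : ℝ) (r : ℝ → ℝ) (x₀ x₁ : ℝ) (Θ : ℝ → ℝ) : Prop where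
  continuous : Continuous Θ
  hasDerivAt : ∀ x ∈ Icc x₀ x₁, HasDerivAt Θ (prueferSpeed p m (r x) (Θ x)) x

theorem hasDerivAt_prueferSpeed (p m r θ : ℝ) :
    HasDerivAt (prueferSpeed p m r)
      (2 * (r - p) * (Real.sin θ * Real.cos θ) + 2 * m * (Real.cos θ ^ 2 - Real.sin θ ^ 2)) θ := by
  have hs := Real.hasDerivAt_sin θ
  have hc := Real.hasDerivAt_cos θ
  have := (((hc.pow 2).const_mul p).add ((hs.mul hc).const_mul (2 * m))).add
    ((hs.pow 2).const_mul r)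
  refine this.congr_deriv ?_
  norm_num
  ring

theorem abs_sin_mul_cos_le (θ : ℝ) : |Real.sin θ * Real.cos θ| ≤ 1 := by
  rw [abs_mul]
  exact mul_le_one₀ (Real.abs_sin_le_one θ) (abs_nonneg _) (Real.abs_cos_le_one θ)

theorem abs_prueferSpeed_le (p m r θ : ℝ) : |prueferSpeed p m r θ| ≤ |p| + 2 * |m| + |r| := by
  have h1 := abs_sin_mul_cos_le θ
  have h2 := Real.cos_sq_le_one θ
  have h3 := Real.sin_sq_le_one θ
  have e1 : |p * Real.cos θ ^ 2| ≤ |p| := by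
    rw [abs_mul, abs_of_nonneg (sq_nonneg (Real.cos θ))]
    exact mul_le_of_le_one_right (abs_nonneg _) h2
  have e2 : |2 * m * (Real.sin θ * Real.cos θ)| ≤ 2 * |m| := by
    rw [abs_mul, abs_mul, abs_two]
    exact mul_le_of_le_one_right (by positivity) h1
  have e3 : |r * Real.sin θ ^ 2| ≤ |r| := by
    rw [abs_mul, abs_of_nonneg (sq_nonneg (Real.sin θ))]
    exact mul_le_of_le_one_right (abs_nonneg _) h3
  unfold prueferSpeed
  exact (abs_add_le _ _).trans (add_le_add ((abs_add_le _ _).trans (add_le_add e1 e2)) e3)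

theorem lipschitzWith_prueferSpeed (p m r : ℝ) :
    LipschitzWith (2 * (|r| + |p|) + 4 * |m|).toNNReal (prueferSpeed p m r) := by
  refine lipschitzWith_of_nnnorm_deriv_le
    (fun θ => (hasDerivAt_prueferSpeed p m r θ).differentiableAt) fun θ => ?_
  rw [← NNReal.coe_le_coe, coe_nnnorm, (hasDerivAt_prueferSpeed p m r θ).deriv,
    Real.coe_toNNReal _ (by positivity), Real.norm_eq_abs]
  have h1 := abs_sin_mul_cos_le θ
  have h2 : |Real.cos θ ^ 2 - Real.sin θ ^ 2| ≤ 2 := by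
    have := Real.cos_sq_le_one θ
    have := Real.sin_sq_le_one θ
    rw [abs_le]
    constructor <;> nlinarith [sq_nonneg (Real.cos θ), sq_nonneg (Real.sin θ)]
  have e1 : |2 * (r - p) * (Real.sin θ * Real.cos θ)| ≤ 2 * (|r| + |p|) := by
    rw [abs_mul, abs_mul, abs_two]
    calc 2 * |r - p| * |Real.sin θ * Real.cos θ| ≤ 2 * |r - p| * 1 := by gcongr
      _ ≤ 2 * (|r| + |p|) := by linarith [abs_sub r p]
  have e2 : |2 * m * (Real.cos θ ^ 2 - Real.sin θ ^ 2)| ≤ 4 * |m| := by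
    rw [abs_mul, abs_mul, abs_two]
    calc 2 * |m| * |Real.cos θ ^ 2 - Real.sin θ ^ 2| ≤ 2 * |m| * 2 := by gcongr
      _ = 4 * |m| := by ring
  exact (abs_add_le _ _).trans (add_le_add e1 e2)

theorem exists_isPrueferAngle (p m : ℝ) {r : ℝ → ℝ} (hr : Continuous r) {x₀ x₁ : ℝ}
    (hx : x₀ < x₁) (θ₀ : ℝ) : ∃ Θ, IsPrueferAngle p m r x₀ x₁ Θ ∧ Θ x₀ = θ₀ := by
  obtain ⟨M, hM⟩ := (isCompact_Icc (a := x₀ - 1) (b := x₁ + 1)).exists_bound_of_continuousOn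
    hr.continuousOn
  have hM0 : 0 ≤ M := (norm_nonneg _).trans (hM x₀ ⟨by linarith, by linarith⟩)
  -- The speed is bounded on the whole line, so a large enough ball gives a solution on
  -- the whole of `[x₀ - 1, x₁ + 1]`, which has `[x₀, x₁]` in its interior.
  have hPL : IsPicardLindelof (fun x θ => prueferSpeed p m (r x) θ)
      (⟨x₀, by linarith, by linarith⟩ : Icc (x₀ - 1) (x₁ + 1)) θ₀
      ((|p| + 2 * |m| + M) * (x₁ - x₀ + 1)).toNNReal 0 (|p| + 2 * |m| + M).toNNReal
      (2 * (M + |p|) + 4 * |m|).toNNReal := by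
    refine ⟨fun t ht => ?_, fun θ _ => ?_, fun t ht θ _ => ?_, ?_⟩
    · refine ((lipschitzWith_prueferSpeed p m (r t)).weaken ?_).lipschitzOnWith
      have := hM t ht
      rw [Real.norm_eq_abs] at this
      gcongr
    · unfold prueferSpeed
      fun_prop
    · rw [Real.coe_toNNReal _ (by positivity), Real.norm_eq_abs]
      have := hM t ht
      rw [Real.norm_eq_abs] at this
      exact (abs_prueferSpeed_le p m (r t) θ).trans (by gcongr)
    · rw [Real.coe_toNNReal _ (by positivity), Real.coe_toNNReal _ (by
        have : 0 ≤ x₁ - x₀ + 1 := by linarith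
        positivity)]
      simp only [NNReal.coe_zero, sub_zero]
      refine mul_le_mul_of_nonneg_left (max_le ?_ ?_) (by positivity) <;> linarith
  obtain ⟨α, h0, hα⟩ := hPL.exists_eq_forall_mem_Icc_hasDerivWithinAt₀
  have hle : x₀ - 1 ≤ x₁ + 1 := by linarith
  have hc : ContinuousOn α (Icc (x₀ - 1) (x₁ + 1)) := fun x hx => (hα x hx).continuousWithinAt
  refine ⟨IccExtend hle (fun x : Icc (x₀ - 1) (x₁ + 1) => α x), ⟨?_, ?_⟩, ?_⟩
  · exact (continuousOn_iff_continuous_domRestrict.1 hc).Icc_extend'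
  · intro x hx
    have hmem : Icc (x₀ - 1) (x₁ + 1) ∈ 𝓝 x :=
      Icc_mem_nhds (by linarith [hx.1]) (by linarith [hx.2])
    have hx' := mem_of_mem_nhds hmem
    rw [IccExtend_of_mem hle _ hx']
    refine ((hα x hx').hasDerivAt hmem).congr_of_eventuallyEq ?_
    filter_upwards [hmem] with z hz
    rw [IccExtend_of_mem hle _ hz]
  · rw [IccExtend_of_mem hle _ ⟨by linarith, by linarith⟩]
    exact h0

section Comparison

variable {p m x₀ x₁ : ℝ} {r r₁ r₂ Θ Θ₁ Θ₂ : ℝ → ℝ}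

/-- The coefficient of the linear equation satisfied by the difference of two Prüfer angles. -/
noncomputable def prueferDiffCoeff (p m r θ₁ θ₂ : ℝ) : ℝ :=
  Real.sinc (θ₂ - θ₁) * ((r - p) * Real.sin (θ₁ + θ₂) + 2 * m * Real.cos (θ₁ + θ₂))

theorem prueferSpeed_sub (p m r₁ r₂ θ₁ θ₂ : ℝ) :
    prueferSpeed p m r₂ θ₂ - prueferSpeed p m r₁ θ₁ =
      prueferDiffCoeff p m r₂ θ₁ θ₂ * (θ₂ - θ₁) + (r₂ - r₁) * Real.sin θ₁ ^ 2 := by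
  have h : Real.sinc (θ₂ - θ₁) * (θ₂ - θ₁) = Real.sin (θ₂ - θ₁) := by
    rcases eq_or_ne (θ₂ - θ₁) 0 with h | h
    · rw [h]; simp
    · rw [Real.sinc_of_ne_zero h]; field_simp
  have : prueferDiffCoeff p m r₂ θ₁ θ₂ * (θ₂ - θ₁) = Real.sin (θ₂ - θ₁) *
      ((r₂ - p) * Real.sin (θ₁ + θ₂) + 2 * m * Real.cos (θ₁ + θ₂)) := by
    rw [prueferDiffCoeff, ← h]; ring
  rw [this, Real.sin_sub, Real.sin_add, Real.cos_add]
  unfold prueferSpeed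
  have e1 := Real.sin_sq_add_cos_sq θ₁
  have e2 := Real.sin_sq_add_cos_sq θ₂
  ring_nf
  rw [show Real.cos θ₁ ^ 2 = 1 - Real.sin θ₁ ^ 2 by linarith,
    show Real.cos θ₂ ^ 2 = 1 - Real.sin θ₂ ^ 2 by linarith]
  ring

theorem prueferDiffCoeff_le (p m r θ₁ θ₂ : ℝ) :
    prueferDiffCoeff p m r θ₁ θ₂ ≤ |r| + |p| + 2 * |m| := by
  refine (le_abs_self _).trans ?_
  rw [prueferDiffCoeff, abs_mul]
  have h1 : |Real.sinc (θ₂ - θ₁)| ≤ 1 := Real.abs_sinc_le_one _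
  have h2 : |(r - p) * Real.sin (θ₁ + θ₂) + 2 * m * Real.cos (θ₁ + θ₂)| ≤ |r| + |p| + 2 * |m| := by
    refine (abs_add_le _ _).trans (add_le_add ?_ ?_)
    · rw [abs_mul]
      exact (mul_le_of_le_one_right (abs_nonneg _) (Real.abs_sin_le_one _)).trans (abs_sub r p)
    · rw [abs_mul, abs_mul, abs_two]
      exact mul_le_of_le_one_right (by positivity) (Real.abs_cos_le_one _)
  exact (mul_le_of_le_one_left (abs_nonneg _) h1).trans h2

/-- With the integrating factor `exp (-∫ G)`, where `G` is `prueferDiffCoeff`, the difference of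
two Prüfer angles has derivative `(r₂ - r₁) sin² Θ₁` up to a positive factor. -/
theorem IsPrueferAngle.exists_integratingFactor (h₁ : IsPrueferAngle p m r₁ x₀ x₁ Θ₁)
    (h₂ : IsPrueferAngle p m r₂ x₀ x₁ Θ₂) (hr : Continuous r₂) :
    ∃ E : ℝ → ℝ, (∀ x, 0 < E x) ∧ ∀ x ∈ Icc x₀ x₁,
      HasDerivAt (fun x => E x * (Θ₂ x - Θ₁ x))
        (E x * ((r₂ x - r₁ x) * Real.sin (Θ₁ x) ^ 2)) x := by
  set G : ℝ → ℝ := fun x => prueferDiffCoeff p m (r₂ x) (Θ₁ x) (Θ₂ x) with hG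
  have hGc : Continuous G := by
    have := h₁.continuous
    have := h₂.continuous
    have hs : Continuous Real.sinc := Real.continuous_sinc
    unfold G prueferDiffCoeff
    fun_prop
  refine ⟨fun x => Real.exp (-∫ t in x₀..x, G t), fun x => Real.exp_pos _, fun x hx => ?_⟩
  have hE : HasDerivAt (fun x => Real.exp (-∫ t in x₀..x, G t))
      (Real.exp (-∫ t in x₀..x, G t) * -G x) x :=
    (intervalIntegral.integral_hasDerivAt_right (hGc.intervalIntegrable _ _)
      (hGc.stronglyMeasurableAtFilter _ _) hGc.continuousAt).neg.exp
  refine (hE.mul ((h₂.hasDerivAt x hx).sub (h₁.hasDerivAt x hx))).congr_deriv ?_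
  rw [prueferSpeed_sub, Pi.sub_apply]
  simp only [hG]
  ring

theorem monotoneOn_Icc_of_hasDerivAt_nonneg {f f' : ℝ → ℝ}
    (h : ∀ x ∈ Icc x₀ x₁, HasDerivAt f (f' x) x) (h0 : ∀ x ∈ Icc x₀ x₁, 0 ≤ f' x) :
    MonotoneOn f (Icc x₀ x₁) := by
  refine monotoneOn_of_deriv_nonneg (convex_Icc _ _)
    (fun x hx => (h x hx).continuousAt.continuousWithinAt)
    (fun x hx => (h x (interior_subset hx)).differentiableAt.differentiableWithinAt)
    (fun x hx => ?_)
  rw [(h x (interior_subset hx)).deriv]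
  exact h0 x (interior_subset hx)

theorem IsPrueferAngle.le_of_le (h₁ : IsPrueferAngle p m r₁ x₀ x₁ Θ₁)
    (h₂ : IsPrueferAngle p m r₂ x₀ x₁ Θ₂) (hr : Continuous r₂)
    (hle : ∀ x ∈ Icc x₀ x₁, r₁ x ≤ r₂ x) (h0 : Θ₁ x₀ ≤ Θ₂ x₀) :
    ∀ x ∈ Icc x₀ x₁, Θ₁ x ≤ Θ₂ x := by
  intro x hx
  obtain ⟨E, hE, hd⟩ := h₁.exists_integratingFactor h₂ hr
  have hmono := monotoneOn_Icc_of_hasDerivAt_nonneg hd fun z hz =>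
    mul_nonneg (hE z).le (mul_nonneg (sub_nonneg.2 (hle z hz)) (sq_nonneg _))
  have h := hmono ⟨le_rfl, hx.1.trans hx.2⟩ hx hx.1
  have h' : 0 ≤ E x * (Θ₂ x - Θ₁ x) := (mul_nonneg (hE _).le (sub_nonneg.2 h0)).trans h
  exact sub_nonneg.1 (nonneg_of_mul_nonneg_right h' (hE x))

/-- Strict comparison: a strictly larger coefficient of `sin²` gives a strictly larger angle,
because `sin Θ` cannot vanish on an interval (the angle turns at speed `p > 0` where it does). -/
theorem IsPrueferAngle.lt_of_lt (h₁ : IsPrueferAngle p m r₁ x₀ x₁ Θ₁)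
    (h₂ : IsPrueferAngle p m r₂ x₀ x₁ Θ₂) (hr : Continuous r₂) (hp : 0 < p) (hx : x₀ < x₁)
    (hlt : ∀ x ∈ Icc x₀ x₁, r₁ x < r₂ x) (h0 : Θ₁ x₀ ≤ Θ₂ x₀) : Θ₁ x₁ < Θ₂ x₁ := by
  by_contra hcon
  push Not at hcon
  obtain ⟨E, hE, hd⟩ := h₁.exists_integratingFactor h₂ hr
  have hmono := monotoneOn_Icc_of_hasDerivAt_nonneg hd fun z hz =>
    mul_nonneg (hE z).le (mul_nonneg (sub_nonneg.2 (hlt z hz).le) (sq_nonneg _))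
  have hzero : ∀ x ∈ Icc x₀ x₁, E x * (Θ₂ x - Θ₁ x) = 0 := by
    intro x hx'
    have l := hmono ⟨le_rfl, hx.le⟩ hx' hx'.1
    have u := hmono hx' ⟨hx.le, le_rfl⟩ hx'.2
    have l' : 0 ≤ E x₀ * (Θ₂ x₀ - Θ₁ x₀) := mul_nonneg (hE _).le (sub_nonneg.2 h0)
    have u' : E x₁ * (Θ₂ x₁ - Θ₁ x₁) ≤ 0 :=
      mul_nonpos_of_nonneg_of_nonpos (hE _).le (sub_nonpos.2 hcon)
    simp only at l u
    linarith
  have hsin : ∀ x ∈ Ioo x₀ x₁, Real.sin (Θ₁ x) = 0 := by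
    intro x hx'
    have hev : (fun x => E x * (Θ₂ x - Θ₁ x)) =ᶠ[𝓝 x] fun _ => 0 := by
      filter_upwards [Icc_mem_nhds hx'.1 hx'.2] with z hz using hzero z hz
    have := (hd x (Ioo_subset_Icc_self hx')).unique
      ((hasDerivAt_const x (0 : ℝ)).congr_of_eventuallyEq hev)
    have hpos := sub_pos.2 (hlt x (Ioo_subset_Icc_self hx'))
    rcases mul_eq_zero.1 this with h | h
    · exact absurd h (hE x).ne'
    · rcases mul_eq_zero.1 h with h | h
      · exact absurd h hpos.ne'
      · exact pow_eq_zero_iff (two_ne_zero) |>.1 h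
  have hmid : (x₀ + x₁) / 2 ∈ Ioo x₀ x₁ := ⟨by linarith, by linarith⟩
  set z := (x₀ + x₁) / 2
  have hev : (fun x => Real.sin (Θ₁ x)) =ᶠ[𝓝 z] fun _ => 0 := by
    filter_upwards [Ioo_mem_nhds hmid.1 hmid.2] with z hz using hsin z hz
  have := (h₁.hasDerivAt z (Ioo_subset_Icc_self hmid)).sin.unique
      ((hasDerivAt_const z (0 : ℝ)).congr_of_eventuallyEq hev)
  have hs := hsin z hmid
  have hc : Real.cos (Θ₁ z) ^ 2 = 1 := by
    have := Real.sin_sq_add_cos_sq (Θ₁ z)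
    rw [hs] at this
    linarith
  rw [prueferSpeed, hs, hc] at this
  have hc0 : Real.cos (Θ₁ z) ≠ 0 := by
    intro h
    rw [h] at hc
    norm_num at hc
  have hp' : p = 0 := by
    simpa [hc0] using this
  exact hp.ne' hp'

theorem IsPrueferAngle.sub_le_exp_mul {K η : ℝ} (h₁ : IsPrueferAngle p m r₁ x₀ x₁ Θ₁)
    (h₂ : IsPrueferAngle p m r₂ x₀ x₁ Θ₂) (hr : Continuous r₂) (hx : x₀ ≤ x₁)
    (hle : ∀ x ∈ Icc x₀ x₁, r₁ x ≤ r₂ x) (h0 : Θ₁ x₀ ≤ Θ₂ x₀) (hK0 : 0 ≤ K) (hη : 0 ≤ η)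
    (hle' : ∀ x ∈ Icc x₀ x₁, r₂ x ≤ r₁ x + η) (hK : ∀ x ∈ Icc x₀ x₁, |r₂ x| + |p| + 2 * |m| ≤ K) :
    Θ₂ x₁ - Θ₁ x₁ ≤ Real.exp (K * (x₁ - x₀)) * (Θ₂ x₀ - Θ₁ x₀ + η * (x₁ - x₀)) := by
  have hd : ∀ x ∈ Icc x₀ x₁, HasDerivAt
      (fun x => η * x - Real.exp (-(K * (x - x₀))) * (Θ₂ x - Θ₁ x))
      (η - (Real.exp (-(K * (x - x₀))) * -K * (Θ₂ x - Θ₁ x) + Real.exp (-(K * (x - x₀))) *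
        (prueferSpeed p m (r₂ x) (Θ₂ x) - prueferSpeed p m (r₁ x) (Θ₁ x)))) x := by
    intro x hx'
    have e : HasDerivAt (fun x => Real.exp (-(K * (x - x₀))))
        (Real.exp (-(K * (x - x₀))) * -K) x := by
      have : HasDerivAt (fun x => -(K * (x - x₀))) (-K) x := by
        simpa using (((hasDerivAt_id x).sub_const x₀).const_mul K).fun_neg
      exact this.exp
    have := ((hasDerivAt_id x).const_mul η).fun_sub
      (e.fun_mul ((h₂.hasDerivAt x hx').fun_sub (h₁.hasDerivAt x hx')))
    simpa using this
  have hmono := monotoneOn_Icc_of_hasDerivAt_nonneg hd fun x hx' => by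
    rw [prueferSpeed_sub]
    have hE1 : Real.exp (-(K * (x - x₀))) ≤ 1 :=
      Real.exp_le_one_iff.2 (by
        have := mul_nonneg hK0 (sub_nonneg.2 hx'.1)
        linarith)
    have hE0 := Real.exp_pos (-(K * (x - x₀)))
    set e := Real.exp (-(K * (x - x₀)))
    have hδ : 0 ≤ Θ₂ x - Θ₁ x := sub_nonneg.2 (h₁.le_of_le h₂ hr hle h0 x hx')
    have hG := (prueferDiffCoeff_le p m (r₂ x) (Θ₁ x) (Θ₂ x)).trans (hK x hx')
    have h3 : (r₂ x - r₁ x) * Real.sin (Θ₁ x) ^ 2 ≤ η :=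
      (mul_le_of_le_one_right (sub_nonneg.2 (hle x hx')) (Real.sin_sq_le_one _)).trans
        (by linarith [hle' x hx'])
    have h4 := mul_le_mul_of_nonneg_right hG hδ
    have h5 : e * (prueferDiffCoeff p m (r₂ x) (Θ₁ x) (Θ₂ x) * (Θ₂ x - Θ₁ x) +
        (r₂ x - r₁ x) * Real.sin (Θ₁ x) ^ 2 - K * (Θ₂ x - Θ₁ x)) ≤ e * η :=
      mul_le_mul_of_nonneg_left (by linarith) hE0.le
    have h6 : e * η ≤ η := mul_le_of_le_one_left hη hE1
    linarith
  have h := hmono ⟨le_rfl, hx⟩ ⟨hx, le_rfl⟩ hx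
  simp only [sub_self, mul_zero, neg_zero, Real.exp_zero, one_mul] at h
  have h' : Real.exp (-(K * (x₁ - x₀))) * (Θ₂ x₁ - Θ₁ x₁) ≤ Θ₂ x₀ - Θ₁ x₀ + η * (x₁ - x₀) := by
    linarith
  have := mul_le_mul_of_nonneg_left h' (Real.exp_pos (K * (x₁ - x₀))).le
  rwa [← mul_assoc, ← Real.exp_add, add_neg_cancel, Real.exp_zero, one_mul] at this

/-- The speed is `p > 0` at angle `0`, so an angle cannot cross `0` downwards. -/
theorem IsPrueferAngle.nonneg (h : IsPrueferAngle p m r x₀ x₁ Θ) (hp : 0 < p) (hx : x₀ ≤ x₁)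
    (h0 : 0 ≤ Θ x₀) : 0 ≤ Θ x₁ := by
  refine image_le_of_deriv_right_lt_deriv_boundary' (f := fun _ => 0) (f' := fun _ => 0)
    continuousOn_const (fun x _ => hasDerivWithinAt_const _ _ _) h0 h.continuous.continuousOn
    (fun x hx' => (h.hasDerivAt x (Ico_subset_Icc_self hx')).hasDerivWithinAt)
    (fun x _ he => ?_) ⟨hx, le_rfl⟩
  rw [← he]
  simpa [prueferSpeed] using hp

/-- If `r` is very negative, the angle falls below `ε`: the line from `(x₀, π - ε)` to `(x₁, ε)`
is a barrier which it cannot cross. -/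
theorem IsPrueferAngle.le_of_barrier {ε : ℝ} (h : IsPrueferAngle p m r x₀ x₁ Θ) (hx : x₀ < x₁)
    (hε : 0 < ε) (hε' : ε < Real.pi / 2) (h0 : Θ x₀ ≤ Real.pi - ε)
    (hr : ∀ x ∈ Icc x₀ x₁, r x * Real.sin ε ^ 2 <
      -(|p| + 2 * |m|) - (Real.pi - 2 * ε) / (x₁ - x₀)) (hr0 : ∀ x ∈ Icc x₀ x₁, r x ≤ 0) :
    Θ x₁ ≤ ε := by
  set M := (Real.pi - 2 * ε) / (x₁ - x₀) with hM
  have hl : 0 < x₁ - x₀ := sub_pos.2 hx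
  have hM0 : 0 ≤ M := div_nonneg (by linarith) hl.le
  have hMl : M * (x₁ - x₀) = Real.pi - 2 * ε := by rw [hM]; field_simp
  have hB : ∀ x, HasDerivAt (fun x => Real.pi - ε - M * (x - x₀)) (-M) x := by
    intro x
    simpa using (((hasDerivAt_id x).sub_const x₀).const_mul M).const_sub (Real.pi - ε)
  have := image_le_of_deriv_right_lt_deriv_boundary' h.continuous.continuousOn
    (fun x hx' => (h.hasDerivAt x (Ico_subset_Icc_self hx')).hasDerivWithinAt)
    (B := fun x => Real.pi - ε - M * (x - x₀)) (B' := fun _ => -M) (by simpa using h0)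
    (fun x _ => (hB x).continuousAt.continuousWithinAt) (fun x _ => (hB x).hasDerivWithinAt)
    (fun x hx' he => ?_) ⟨hx.le, le_rfl⟩
  · have h2 : Real.pi - ε - M * (x₁ - x₀) = ε := by rw [hMl]; ring
    simpa [h2] using this
  · have hle1 : M * (x - x₀) ≤ M * (x₁ - x₀) :=
      mul_le_mul_of_nonneg_left (by linarith [hx'.2]) hM0
    have hle0 : 0 ≤ M * (x - x₀) := mul_nonneg hM0 (sub_nonneg.2 hx'.1)
    have hlo : ε ≤ Θ x := by rw [he]; linarith
    have hhi : Θ x ≤ Real.pi - ε := by rw [he]; linarith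
    have hsin : Real.sin ε ≤ Real.sin (Θ x) := by
      rcases le_total (Θ x) (Real.pi / 2) with h' | h'
      · exact Real.sin_le_sin_of_le_of_le_pi_div_two (by linarith) h' hlo
      · rw [← Real.sin_pi_sub (Θ x)]
        exact Real.sin_le_sin_of_le_of_le_pi_div_two (by linarith) (by linarith) (by linarith)
    have hs0 : 0 < Real.sin ε := Real.sin_pos_of_pos_of_lt_pi hε (by linarith)
    have hsq : Real.sin ε ^ 2 ≤ Real.sin (Θ x) ^ 2 := by gcongr
    have hmem := Ico_subset_Icc_self hx'
    have h1 : r x * Real.sin (Θ x) ^ 2 ≤ r x * Real.sin ε ^ 2 :=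
      mul_le_mul_of_nonpos_left hsq (hr0 x hmem)
    have h2 := hr x hmem
    have h3 := (le_abs_self _).trans (abs_prueferSpeed_le p m 0 (Θ x))
    have h4 : prueferSpeed p m (r x) (Θ x) = prueferSpeed p m 0 (Θ x) +
        r x * Real.sin (Θ x) ^ 2 := by simp [prueferSpeed]
    rw [h4]
    rw [abs_zero] at h3
    linarith

end Comparison

/-! ### Solutions of the equation on one side of the transmission point -/

/-- `y`, with derivative `dy`, solves `-y'' + Q y = mu y` on `[x₀, x₁)`. -/
structure IsHalfSolution (Q : ℝ → ℝ) (mu : ℂ) (x₀ x₁ : ℝ) (y dy : ℝ → ℂ) : Prop where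
  deriv_fst : ∀ x ∈ Ico x₀ x₁, HasDerivWithinAt y (dy x) (Ico x₀ x₁) x
  deriv_snd : ∀ x ∈ Ico x₀ x₁, HasDerivWithinAt dy (((Q x : ℂ) - mu) * y x) (Ico x₀ x₁) x

/-- A non-trivial real solution `φ`, with derivative `dφ`, of `-φ'' + Q φ = lam φ` on `[x₀, x₁]`,
continuous on the whole line and differentiable in the two-sided sense at the endpoints. -/
structure IsRealSolution (Q : ℝ → ℝ) (lam x₀ x₁ : ℝ) (φ dφ : ℝ → ℝ) : Prop where
  continuous_fst : Continuous φ
  continuous_snd : Continuous dφ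
  deriv_fst : ∀ x ∈ Icc x₀ x₁, HasDerivAt φ (dφ x) x
  deriv_snd : ∀ x ∈ Icc x₀ x₁, HasDerivAt dφ ((Q x - lam) * φ x) x
  ne_zero : ∀ x, φ x ^ 2 + dφ x ^ 2 ≠ 0

theorem eq_of_hasDerivWithinAt_Ico_zero {E : Type*} [NormedAddCommGroup E] [NormedSpace ℝ E]
    {f : ℝ → E} {x₀ x₁ x : ℝ} (h : ∀ x ∈ Ico x₀ x₁, HasDerivWithinAt f 0 (Ico x₀ x₁) x)
    (hx : x ∈ Ico x₀ x₁) : f x = f x₀ := by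
  refine constant_of_has_deriv_right_zero (a := x₀) (b := x) (fun t ht => ?_) (fun t ht => ?_) x
    ⟨hx.1, le_rfl⟩
  · exact ((h t ⟨ht.1, ht.2.trans_lt hx.2⟩).continuousWithinAt).mono
      fun s hs => ⟨hs.1, hs.2.trans_lt hx.2⟩
  · have ht' : t ∈ Ico x₀ x₁ := ⟨ht.1, ht.2.trans hx.2⟩
    refine (h t ht').mono_of_mem_nhdsWithin ?_
    exact mem_of_superset (Ico_mem_nhdsGE ht'.2) (Ico_subset_Ico_left ht.1)

theorem antitoneOn_Ico_of_hasDerivWithinAt_nonpos {f f' : ℝ → ℝ} {x₀ x₁ : ℝ}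
    (h : ∀ x ∈ Ico x₀ x₁, HasDerivWithinAt f (f' x) (Ico x₀ x₁) x)
    (h0 : ∀ x ∈ Ico x₀ x₁, f' x ≤ 0) : AntitoneOn f (Ico x₀ x₁) := by
  have hd : ∀ x ∈ interior (Ico x₀ x₁), HasDerivAt f (f' x) x := fun x hx =>
    (h x (interior_subset hx)).hasDerivAt (mem_interior_iff_mem_nhds.1 hx)
  refine antitoneOn_of_deriv_nonpos (convex_Ico _ _)
    (fun x hx => (h x hx).continuousWithinAt)
    (fun x hx => (hd x hx).differentiableAt.differentiableWithinAt) (fun x hx => ?_)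
  rw [(hd x hx).deriv]
  exact h0 x (interior_subset hx)

section

variable {Q : ℝ → ℝ} {mu : ℂ} {x₀ x₁ : ℝ} {y dy : ℝ → ℂ}

open scoped ComplexConjugate

/-- The Lagrange identity for a solution and its complex conjugate. -/
theorem IsHalfSolution.hasDerivWithinAt_im (h : IsHalfSolution Q mu x₀ x₁ y dy) :
    ∀ x ∈ Ico x₀ x₁, HasDerivWithinAt (fun x => mu.im * (dy x * conj (y x)).im)
      (-(mu.im ^ 2 * ‖y x‖ ^ 2)) (Ico x₀ x₁) x := by
  intro x hx
  have h1 := h.deriv_fst x hx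
  have h2 := h.deriv_snd x hx
  have yr := Complex.reCLM.hasFDerivAt.comp_hasDerivWithinAt x h1
  have yi := Complex.imCLM.hasFDerivAt.comp_hasDerivWithinAt x h1
  have dr := Complex.reCLM.hasFDerivAt.comp_hasDerivWithinAt x h2
  have di := Complex.imCLM.hasFDerivAt.comp_hasDerivWithinAt x h2
  have := ((di.mul yr).sub (dr.mul yi)).const_mul mu.im
  refine (this.congr_of_eventuallyEq (.of_forall fun t => ?_) ?_).congr_deriv ?_
  · simp [sub_eq_add_neg]
    exact Or.inl (add_comm _ _)
  · simp [sub_eq_add_neg]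
    exact Or.inl (add_comm _ _)
  · rw [← Complex.normSq_eq_norm_sq, Complex.normSq_apply]
    simp
    ring

/-- The form `mu.im * Im (dy * conj y)` decreases towards the transmission point. -/
theorem IsHalfSolution.limit_le {ym dym : ℂ} (h : IsHalfSolution Q mu x₀ x₁ y dy)
    (hy : Tendsto y (𝓝[<] x₁) (𝓝 ym)) (hdy : Tendsto dy (𝓝[<] x₁) (𝓝 dym)) :
    ∀ x ∈ Ico x₀ x₁, mu.im * (dym * conj ym).im ≤ mu.im * (dy x * conj (y x)).im := by
  intro x hx'
  have hanti := antitoneOn_Ico_of_hasDerivWithinAt_nonpos h.hasDerivWithinAt_im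
    fun x _ => neg_nonpos.2 (by positivity)
  have hlim : Tendsto (fun x => mu.im * (dy x * conj (y x)).im) (𝓝[<] x₁)
      (𝓝 (mu.im * (dym * conj ym).im)) := by
    have hc : Tendsto (fun x => conj (y x)) (𝓝[<] x₁) (𝓝 (conj ym)) :=
      (Complex.continuous_conj.tendsto ym).comp hy
    exact ((Complex.continuous_im.tendsto _).comp (hdy.mul hc)).const_mul _
  refine le_of_tendsto hlim ?_
  filter_upwards [Ico_mem_nhdsLT hx'.2] with t ht
  exact hanti hx' ⟨hx'.1.trans ht.1, ht.2⟩ ht.1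

theorem IsHalfSolution.eq_zero_of_le_limit {ym dym : ℂ} (h : IsHalfSolution Q mu x₀ x₁ y dy)
    (hx : x₀ < x₁) (hmu : mu.im ≠ 0)
    (hy : Tendsto y (𝓝[<] x₁) (𝓝 ym)) (hdy : Tendsto dy (𝓝[<] x₁) (𝓝 dym))
    (hle : mu.im * (dy x₀ * conj (y x₀)).im ≤ mu.im * (dym * conj ym).im) :
    ∀ x ∈ Ico x₀ x₁, y x = 0 := by
  have hanti := antitoneOn_Ico_of_hasDerivWithinAt_nonpos h.hasDerivWithinAt_im
    fun x _ => neg_nonpos.2 (by positivity)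
  have hx₀ : x₀ ∈ Ico x₀ x₁ := ⟨le_rfl, hx⟩
  have hconst : ∀ x ∈ Ico x₀ x₁, mu.im * (dy x * conj (y x)).im =
      mu.im * (dy x₀ * conj (y x₀)).im := fun x hx' =>
    le_antisymm (hanti hx₀ hx' hx'.1) (hle.trans (h.limit_le hy hdy x hx'))
  intro x hx'
  have hu : UniqueDiffWithinAt ℝ (Ico x₀ x₁) x := uniqueDiffOn_Ico _ _ x hx'
  have h0 : HasDerivWithinAt (fun x => mu.im * (dy x * conj (y x)).im) 0 (Ico x₀ x₁) x :=
    (hasDerivWithinAt_const x _ (mu.im * (dy x₀ * conj (y x₀)).im)).congr hconst (hconst x hx')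
  have h1 := hu.eq_deriv _ (h.hasDerivWithinAt_im x hx') h0
  simpa [hmu] using h1

/-- A solution whose initial vector is parallel to that of a real solution is a constant
multiple of it. -/
theorem IsHalfSolution.exists_eq_const_mul {lam : ℝ} {φ dφ : ℝ → ℝ}
    (h : IsHalfSolution Q lam x₀ x₁ y dy) (hφ : IsRealSolution Q lam x₀ x₁ φ dφ) (hx : x₀ < x₁)
    (h0 : y x₀ * dφ x₀ = dy x₀ * φ x₀) :
    ∃ k : ℂ, ∀ x ∈ Ico x₀ x₁, y x = k * φ x ∧ dy x = k * dφ x := by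
  have e1 : ∀ x ∈ Ico x₀ x₁, HasDerivWithinAt (fun x => (φ x : ℂ)) (dφ x : ℂ) (Ico x₀ x₁) x :=
    fun x hx' => (hφ.deriv_fst x (Ico_subset_Icc_self hx')).ofReal_comp.hasDerivWithinAt
  have e2 : ∀ x ∈ Ico x₀ x₁, HasDerivWithinAt (fun x => (dφ x : ℂ))
      ((Q x - lam) * φ x : ℂ) (Ico x₀ x₁) x := fun x hx' => by
    have := (hφ.deriv_snd x (Ico_subset_Icc_self hx')).ofReal_comp.hasDerivWithinAt
      (s := Ico x₀ x₁)
    push_cast at this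
    exact this
  have hx₀ : x₀ ∈ Ico x₀ x₁ := ⟨le_rfl, hx⟩
  have hW : ∀ x ∈ Ico x₀ x₁, y x * dφ x - dy x * φ x = 0 := by
    intro x hx'
    have := eq_of_hasDerivWithinAt_Ico_zero (f := fun x => y x * dφ x - dy x * φ x)
      (fun t ht => (((h.deriv_fst t ht).fun_mul (e2 t ht)).fun_sub
        ((h.deriv_snd t ht).fun_mul (e1 t ht))).congr_deriv (by ring)) hx'
    simp only [h0, sub_self] at this
    exact this
  set R : ℝ → ℂ := fun x => φ x * φ x + dφ x * dφ x with hR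
  have hR0 : ∀ x, R x ≠ 0 := fun x => by
    have := hφ.ne_zero x
    have e : R x = ((φ x ^ 2 + dφ x ^ 2 : ℝ) : ℂ) := by simp [hR]; ring
    rw [e]
    exact_mod_cast this
  set k : ℝ → ℂ := fun x => (y x * φ x + dy x * dφ x) / R x with hk
  have hyk : ∀ x ∈ Ico x₀ x₁, y x = k x * φ x ∧ dy x = k x * dφ x := by
    intro x hx'
    have hw := hW x hx'
    have hr := hR0 x
    constructor
    · rw [hk]; field_simp
      simp only [hR]
      linear_combination dφ x * hw
    · rw [hk]; field_simp
      simp only [hR]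
      linear_combination -φ x * hw
  have hconst : ∀ x ∈ Ico x₀ x₁, k x = k x₀ := by
    intro x hx'
    refine eq_of_hasDerivWithinAt_Ico_zero (f := k) (fun t ht => ?_) hx'
    have hn := ((h.deriv_fst t ht).fun_mul (e1 t ht)).fun_add
      ((h.deriv_snd t ht).fun_mul (e2 t ht))
    have hd := ((e1 t ht).fun_mul (e1 t ht)).fun_add ((e2 t ht).fun_mul (e2 t ht))
    refine (hn.fun_div hd (hR0 t)).congr_deriv ?_
    obtain ⟨a1, a2⟩ := hyk t ht
    generalize k t = c at a1 a2
    rw [a1, a2, div_eq_zero_iff]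
    left
    ring
  exact ⟨k x₀, fun x hx' => by rw [← hconst x hx']; exact hyk x hx'⟩

end

/-- A Prüfer angle of `(dφ + A φ, κ φ)` carries a real solution `φ` with that angle. -/
theorem IsPrueferAngle.exists_isRealSolution {κ A lam x₀ x₁ : ℝ} {Q Θ : ℝ → ℝ} (hκ : 0 < κ)
    (hQ : Continuous Q)
    (hΘ : IsPrueferAngle κ (-A) (fun x => (lam - Q x + A ^ 2) / κ) x₀ x₁ Θ) :
    ∃ φ dφ ρ : ℝ → ℝ, IsRealSolution Q lam x₀ x₁ φ dφ ∧
      ∀ x, 0 < ρ x ∧ κ * φ x = ρ x * Real.sin (Θ x) ∧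
        dφ x + A * φ x = ρ x * Real.cos (Θ x) := by
  have hc := hΘ.continuous
  set r : ℝ → ℝ := fun x => (lam - Q x + A ^ 2) / κ with hr
  set g : ℝ → ℝ := fun x =>
    Real.sin (Θ x) * (-A * Real.sin (Θ x) + κ * Real.cos (Θ x)) +
      Real.cos (Θ x) * (-r x * Real.sin (Θ x) + A * Real.cos (Θ x)) with hg
  have hgc : Continuous g := by
    unfold g r
    fun_prop
  set ρ : ℝ → ℝ := fun x => Real.exp (∫ t in x₀..x, g t) with hρ
  have hρd : ∀ x, HasDerivAt ρ (ρ x * g x) x := fun x =>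
    (intervalIntegral.integral_hasDerivAt_right (hgc.intervalIntegrable _ _)
      (hgc.stronglyMeasurableAtFilter _ _) hgc.continuousAt).exp
  have hρ0 : ∀ x, 0 < ρ x := fun x => Real.exp_pos _
  have hρc : Continuous ρ := continuous_iff_continuousAt.2 fun x => (hρd x).continuousAt
  have hu : ∀ x ∈ Icc x₀ x₁, HasDerivAt (fun x => ρ x * Real.sin (Θ x))
      (ρ x * (-A * Real.sin (Θ x) + κ * Real.cos (Θ x))) x := fun x hx => by
    refine ((hρd x).fun_mul (hΘ.hasDerivAt x hx).sin).congr_deriv ?_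
    have := Real.sin_sq_add_cos_sq (Θ x)
    simp only [hg, prueferSpeed]
    linear_combination ρ x * (-A * Real.sin (Θ x) + κ * Real.cos (Θ x)) * this
  have hw : ∀ x ∈ Icc x₀ x₁, HasDerivAt (fun x => ρ x * Real.cos (Θ x))
      (ρ x * (-r x * Real.sin (Θ x) + A * Real.cos (Θ x))) x := fun x hx => by
    refine ((hρd x).fun_mul (hΘ.hasDerivAt x hx).cos).congr_deriv ?_
    have := Real.sin_sq_add_cos_sq (Θ x)
    simp only [hg, prueferSpeed]
    linear_combination ρ x * (-r x * Real.sin (Θ x) + A * Real.cos (Θ x)) * this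
  refine ⟨fun x => ρ x * Real.sin (Θ x) / κ,
    fun x => ρ x * Real.cos (Θ x) - A * (ρ x * Real.sin (Θ x) / κ), ρ,
    ⟨by fun_prop, by fun_prop, fun x hx => ?_, fun x hx => ?_, fun x => ?_⟩,
    fun x => ⟨hρ0 x, by field_simp, by ring⟩⟩
  · refine ((hu x hx).div_const κ).congr_deriv ?_
    field_simp
    ring
  · refine ((hw x hx).fun_sub (((hu x hx).div_const κ).const_mul A)).congr_deriv ?_
    simp only [hr]
    field_simp
    ring
  · intro h0
    have h1 : ρ x * Real.sin (Θ x) / κ = 0 :=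
      pow_eq_zero_iff two_ne_zero |>.1
        ((add_eq_zero_iff_of_nonneg (sq_nonneg _) (sq_nonneg _)).1 h0).1
    rw [h1] at h0
    have hs : Real.sin (Θ x) = 0 := by simpa [hκ.ne', (hρ0 x).ne'] using h1
    have hcs : Real.cos (Θ x) = 0 := by simpa [(hρ0 x).ne'] using h0
    have := Real.sin_sq_add_cos_sq (Θ x)
    rw [hs, hcs] at this
    norm_num at this

/-- The Wronskian of two real solutions is constant; in particular it vanishes everywhere if it
vanishes at the left endpoint. -/
theorem IsRealSolution.wronskian_eq_zero {Q : ℝ → ℝ} {lam x₀ x₁ : ℝ} {φ dφ ψ dψ : ℝ → ℝ}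
    (hφ : IsRealSolution Q lam x₀ x₁ φ dφ) (hψ : IsRealSolution Q lam x₀ x₁ ψ dψ)
    (h0 : φ x₀ * dψ x₀ - dφ x₀ * ψ x₀ = 0) :
    ∀ x ∈ Icc x₀ x₁, φ x * dψ x - dφ x * ψ x = 0 := by
  intro x hx
  have hd : ∀ t ∈ Icc x₀ x₁, HasDerivAt (fun x => φ x * dψ x - dφ x * ψ x) 0 t := fun t ht =>
    (((hφ.deriv_fst t ht).fun_mul (hψ.deriv_snd t ht)).fun_sub
      ((hφ.deriv_snd t ht).fun_mul (hψ.deriv_fst t ht))).congr_deriv (by ring)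
  have := constant_of_has_deriv_right_zero
    (fun t ht => (hd t ht).continuousAt.continuousWithinAt)
    (fun t ht => (hd t (Ico_subset_Icc_self ht)).hasDerivWithinAt) x hx
  rw [this, h0]

/-! ### Reduction to two half problems -/

theorem exists_continuous_eqOn_Ico {q : ℝ → ℝ} {x₀ x₁ l : ℝ} (hx : x₀ < x₁)
    (hq : ContinuousOn q (Ico x₀ x₁)) (hl : Tendsto q (𝓝[<] x₁) (𝓝 l)) :
    ∃ Q : ℝ → ℝ, Continuous Q ∧ ∀ x ∈ Ico x₀ x₁, Q x = q x := by
  have hc : ContinuousOn (extendFrom (Ico x₀ x₁) q) (Icc x₀ x₁) := by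
    refine continuousOn_extendFrom (closure_Ico hx.ne).ge fun x hx' => ?_
    rcases hx'.2.lt_or_eq with h | rfl
    · exact ⟨q x, hq x ⟨hx'.1, h⟩⟩
    · exact ⟨l, by rwa [nhdsWithin_Ico_eq_nhdsLT hx]⟩
  refine ⟨IccExtend hx.le (fun x : Icc x₀ x₁ => extendFrom (Ico x₀ x₁) q x),
    (continuousOn_iff_continuous_domRestrict.1 hc).Icc_extend', fun x hx' => ?_⟩
  rw [IccExtend_of_mem hx.le _ (Ico_subset_Icc_self hx')]
  exact extendFrom_eq (subset_closure hx') (hq x hx')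

namespace TransmissionProblem

open scoped ComplexConjugate

/-- The boundary value problem with the right half reflected, so that both halves run towards the
transmission point: `y` on `[a, c)` stands for itself, and `z` on `[-b, -c)` for `x ↦ y (-x)`.
The last four arguments are the limits of `y, dy, z, dz` at the transmission point. -/
structure IsHalfPair (P : TransmissionProblem) (Q₁ Q₂ : ℝ → ℝ) (mu : ℂ) (y dy z dz : ℝ → ℂ)
    (ym dym zm dzm : ℂ) : Prop where
  left : IsHalfSolution Q₁ mu P.a P.c y dy
  right : IsHalfSolution Q₂ mu (-P.b) (-P.c) z dz
  boundary_left : (P.α₁₀ : ℂ) * y P.a + P.α₁₁ * dy P.a = 0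
  boundary_right : (P.α₂₀ + mu * P.α'₂₀) * z (-P.b) + (P.α₂₁ + mu * P.α'₂₁) * dz (-P.b) = 0
  tendsto_y : Tendsto y (𝓝[<] P.c) (𝓝 ym)
  tendsto_dy : Tendsto dy (𝓝[<] P.c) (𝓝 dym)
  tendsto_z : Tendsto z (𝓝[<] (-P.c)) (𝓝 zm)
  tendsto_dz : Tendsto dz (𝓝[<] (-P.c)) (𝓝 dzm)
  transmission₁ : P.βm₁₁ * dym + P.βm₁₀ * ym - P.βp₁₁ * dzm + P.βp₁₀ * zm = 0
  transmission₂ : P.βm₂₁ * dym + P.βm₂₀ * ym - P.βp₂₁ * dzm + P.βp₂₀ * zm = 0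

theorem tendsto_neg_nhdsLT_neg (c : ℝ) : Tendsto (fun x : ℝ => -x) (𝓝[<] (-c)) (𝓝[>] c) := by
  simpa using tendsto_neg_nhdsLT (a := -c)

variable {P : TransmissionProblem} {Q₁ Q₂ : ℝ → ℝ}

theorem IsEigenvalue.exists_isHalfPair {mu : ℂ}
    (hQ₁ : ∀ x ∈ Ico P.a P.c, Q₁ x = P.q x) (hQ₂ : ∀ x ∈ Ico (-P.b) (-P.c), Q₂ x = P.q (-x))
    (h : P.IsEigenvalue mu) : ∃ (y dy z dz : ℝ → ℂ) (ym dym zm dzm : ℂ),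
      P.IsHalfPair Q₁ Q₂ mu y dy z dz ym dym zm dzm ∧
        ((∃ x ∈ Ico P.a P.c, y x ≠ 0) ∨ ∃ x ∈ Ico (-P.b) (-P.c), z x ≠ 0) := by
  obtain ⟨y, dy, ⟨ddy, hs⟩, hl, hr, ⟨ym, dym, yp, dyp, t1, t2, t3, t4, b1, b2⟩, x, hx, hne⟩ := h
  have hmem : ∀ t ∈ Ico (-P.b) (-P.c), -t ∈ P.dom := fun t ht =>
    Or.inr ⟨by linarith [ht.2], by linarith [ht.1]⟩
  have hmaps : MapsTo (fun t : ℝ => -t) (Ico (-P.b) (-P.c)) P.dom := hmem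
  have hneg : ∀ t, HasDerivWithinAt (fun t : ℝ => -t) (-1) (Ico (-P.b) (-P.c)) t := fun t =>
    (hasDerivAt_neg t).hasDerivWithinAt
  have hsub : Ico P.a P.c ⊆ P.dom := subset_union_left
  have hdd : ∀ t ∈ P.dom, ddy t = ((P.q t : ℂ) - mu) * y t := fun t ht => by
    linear_combination -(hs t ht).2.2
  refine ⟨y, dy, fun t => y (-t), fun t => -dy (-t), ym, dym, yp, -dyp,
    ⟨⟨fun t ht => (hs t (hsub ht)).1.mono hsub, fun t ht => ?_⟩, ⟨fun t ht => ?_, fun t ht => ?_⟩,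
      hl, ?_, t1, t2, t3.comp (tendsto_neg_nhdsLT_neg _),
      (t4.comp (tendsto_neg_nhdsLT_neg _)).neg, ?_, ?_⟩, ?_⟩
  · rw [hQ₁ t ht, ← hdd t (hsub ht)]
    exact (hs t (hsub ht)).2.1.mono hsub
  · have := HasDerivWithinAt.scomp t (hs (-t) (hmem t ht)).1 (hneg t) hmaps
    exact this.congr_deriv (by simp)
  · have := (HasDerivWithinAt.scomp t (hs (-t) (hmem t ht)).2.1 (hneg t) hmaps).neg
    rw [hQ₂ t ht, ← hdd _ (hmem t ht)]
    refine this.congr_deriv ?_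
    simp
  · have : (P.α₂₀ : ℂ) * y P.b - P.α₂₁ * dy P.b + mu * (P.α'₂₀ * y P.b - P.α'₂₁ * dy P.b) = 0 := hr
    simp only [neg_neg]
    linear_combination this
  · linear_combination b1
  · linear_combination b2
  · rcases hx with hx | hx
    · exact Or.inl ⟨x, hx, hne⟩
    · exact Or.inr ⟨-x, ⟨by linarith [hx.2], by linarith [hx.1]⟩, by simpa using hne⟩

theorem IsHalfPair.isEigenvalue {mu : ℂ} {y dy z dz : ℝ → ℂ} {ym dym zm dzm : ℂ}
    (hac : P.a < P.c) (hcb : P.c < P.b)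
    (hQ₁ : ∀ x ∈ Ico P.a P.c, Q₁ x = P.q x) (hQ₂ : ∀ x ∈ Ico (-P.b) (-P.c), Q₂ x = P.q (-x))
    (h : P.IsHalfPair Q₁ Q₂ mu y dy z dz ym dym zm dzm)
    (hne : (∃ x ∈ Ico P.a P.c, y x ≠ 0) ∨ ∃ x ∈ Ico (-P.b) (-P.c), z x ≠ 0) :
    P.IsEigenvalue mu := by
  set Y : ℝ → ℂ := fun x => if x < P.c then y x else z (-x) with hY
  set dY : ℝ → ℂ := fun x => if x < P.c then dy x else -dz (-x) with hdY
  have eqL : ∀ x, x < P.c → Y x = y x ∧ dY x = dy x := fun x hx => by simp [hY, hdY, hx]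
  have eqR : ∀ x, P.c ≤ x → Y x = z (-x) ∧ dY x = -dz (-x) := fun x hx => by
    simp [hY, hdY, hx.not_gt]
  refine ⟨Y, dY, ⟨fun x => ((P.q x : ℂ) - mu) * Y x, fun x hx => ?_⟩, ?_, ?_,
    ⟨ym, dym, zm, -dzm, ?_, ?_, ?_, ?_, ?_, ?_⟩, ?_⟩
  · rcases hx with hx | hx
    · have hn : Iio P.c ∈ 𝓝[P.dom] x := mem_nhdsWithin_of_mem_nhds (Iio_mem_nhds hx.2)
      have hn' : Ico P.a P.c ∈ 𝓝[P.dom] x := by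
        filter_upwards [hn, self_mem_nhdsWithin] with t ht ht'
        rcases ht' with ht' | ht'
        · exact ht'
        · exact absurd (lt_trans ht ht'.1) (lt_irrefl _)
      obtain ⟨e1, e2⟩ := eqL x hx.2
      refine ⟨?_, ?_, by ring⟩
      · rw [e2]
        refine ((h.left.deriv_fst x hx).mono_of_mem_nhdsWithin hn').congr_of_eventuallyEq ?_ e1
        filter_upwards [hn] with t ht using (eqL t ht).1
      · change HasDerivWithinAt dY (((P.q x : ℂ) - mu) * Y x) P.dom x
        rw [e1, ← hQ₁ x hx]
        refine ((h.left.deriv_snd x hx).mono_of_mem_nhdsWithin hn').congr_of_eventuallyEq ?_ e2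
        filter_upwards [hn] with t ht using (eqL t ht).2
    · have hn : Ioi P.c ∈ 𝓝[P.dom] x := mem_nhdsWithin_of_mem_nhds (Ioi_mem_nhds hx.1)
      have hn' : Ioc P.c P.b ∈ 𝓝[P.dom] x := by
        filter_upwards [hn, self_mem_nhdsWithin] with t ht ht'
        rcases ht' with ht' | ht'
        · exact absurd (lt_trans ht ht'.2) (lt_irrefl _)
        · exact ht'
      have hmaps : MapsTo (fun t : ℝ => -t) (Ioc P.c P.b) (Ico (-P.b) (-P.c)) := fun t ht =>
        ⟨neg_le_neg ht.2, neg_lt_neg ht.1⟩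
      have hneg : HasDerivWithinAt (fun t : ℝ => -t) (-1) (Ioc P.c P.b) x :=
        (hasDerivAt_neg x).hasDerivWithinAt
      obtain ⟨e1, e2⟩ := eqR x hx.1.le
      refine ⟨?_, ?_, by ring⟩
      · rw [e2]
        have := HasDerivWithinAt.scomp x (h.right.deriv_fst (-x) (hmaps hx)) hneg hmaps
        refine (((this.congr_deriv (by simp))).mono_of_mem_nhdsWithin hn').congr_of_eventuallyEq
          ?_ e1
        filter_upwards [hn] with t ht using (eqR t (le_of_lt ht)).1
      · have := (HasDerivWithinAt.scomp x (h.right.deriv_snd (-x) (hmaps hx)) hneg hmaps).neg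
        have hq : Q₂ (-x) = P.q x := by simpa using hQ₂ (-x) (hmaps hx)
        refine ((this.congr_deriv ?_).mono_of_mem_nhdsWithin hn').congr_of_eventuallyEq ?_ e2
        · simp [e1, hq]
        · filter_upwards [hn] with t ht using (eqR t (le_of_lt ht)).2
  · obtain ⟨e1, e2⟩ := eqL P.a hac
    unfold BoundaryLeft
    rw [e1, e2]
    exact h.boundary_left
  · obtain ⟨e1, e2⟩ := eqR P.b hcb.le
    unfold BoundaryRight
    rw [e1, e2]
    linear_combination h.boundary_right
  · refine h.tendsto_y.congr' ?_
    filter_upwards [self_mem_nhdsWithin] with t ht using (eqL t ht).1.symm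
  · refine h.tendsto_dy.congr' ?_
    filter_upwards [self_mem_nhdsWithin] with t ht using (eqL t ht).2.symm
  · refine (h.tendsto_z.comp tendsto_neg_nhdsGT).congr' ?_
    filter_upwards [self_mem_nhdsWithin] with t ht using (eqR t (le_of_lt ht)).1.symm
  · refine (h.tendsto_dz.comp tendsto_neg_nhdsGT).neg.congr' ?_
    filter_upwards [self_mem_nhdsWithin] with t ht using (eqR t (le_of_lt ht)).2.symm
  · linear_combination h.transmission₁
  · linear_combination h.transmission₂
  · rcases hne with ⟨x, hx, hne⟩ | ⟨x, hx, hne⟩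
    · exact ⟨x, Or.inl hx, by rwa [(eqL x hx.2).1]⟩
    · refine ⟨-x, Or.inr ⟨by linarith [hx.2], by linarith [hx.1]⟩, ?_⟩
      rwa [(eqR (-x) (by linarith [hx.2])).1, neg_neg]

theorem Δ₀_eq (P : TransmissionProblem) : P.Δ₀ = P.α₂₁ * P.α'₂₀ - P.α₂₀ * P.α'₂₁ := by
  simp [Δ₀, A₀, Matrix.det_fin_two]

theorem minor_eq (P : TransmissionProblem) (k j : Fin 4) :
    P.minor k j = P.A 0 k * P.A 1 j - P.A 0 j * P.A 1 k := by
  simp [minor, Matrix.det_fin_two]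

theorem Δ₁₂_eq (P : TransmissionProblem) : P.Δ₁₂ = P.βm₁₀ * P.βm₂₁ - P.βm₁₁ * P.βm₂₀ := by
  simp [Δ₁₂, minor_eq, A]

theorem Δ₃₄_eq (P : TransmissionProblem) : P.Δ₃₄ = P.βp₁₀ * P.βp₂₁ - P.βp₁₁ * P.βp₂₀ := by
  simp [Δ₃₄, minor_eq, A]

theorem Δ₂₄_eq (P : TransmissionProblem) : P.Δ₂₄ = P.βm₁₁ * P.βp₂₁ - P.βp₁₁ * P.βm₂₁ := by
  simp [Δ₂₄, minor_eq, A]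

/-- A complex vector annihilated by a non-zero real row is a multiple of a real vector, on which
the form `Im (v * conj u)` vanishes. -/
theorem im_mul_conj_eq_zero {r s : ℝ} {u v : ℂ} (hrs : r ≠ 0 ∨ s ≠ 0)
    (h : (r : ℂ) * u + s * v = 0) : (v * conj u).im = 0 := by
  have h1 := congrArg Complex.re h
  have h2 := congrArg Complex.im h
  simp at h1 h2
  simp only [Complex.mul_im, Complex.conj_re, Complex.conj_im]
  rcases hrs with hr | hs
  · apply mul_left_cancel₀ hr
    linear_combination v.im * h1 - v.re * h2
  · apply mul_left_cancel₀ hs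
    linear_combination u.re * h2 - u.im * h1

/-- Self-adjointness: the form `mu.im * Im (y' * conj y)` decreases on both halves from a value
that is at most `0`, while the transmission conditions make a positive combination of its two
limits vanish. So it is constant, which forces `y = 0` unless `mu` is real. -/
theorem IsHalfPair.im_eq_zero {mu : ℂ} {y dy z dz : ℝ → ℂ} {ym dym zm dzm : ℂ}
    (hac : P.a < P.c) (hcb : P.c < P.b) (hα : P.α₁₀ ≠ 0 ∨ P.α₁₁ ≠ 0)
    (hΔ₀ : 0 < P.Δ₀) (hΔ₁₂ : 0 < P.Δ₁₂) (hΔ₃₄ : 0 < P.Δ₃₄)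
    (h : P.IsHalfPair Q₁ Q₂ mu y dy z dz ym dym zm dzm)
    (hne : (∃ x ∈ Ico P.a P.c, y x ≠ 0) ∨ ∃ x ∈ Ico (-P.b) (-P.c), z x ≠ 0) : mu.im = 0 := by
  by_contra hmu
  have hbc : -P.b < -P.c := neg_lt_neg hcb
  have hL0 : (dy P.a * conj (y P.a)).im = 0 := im_mul_conj_eq_zero hα h.boundary_left
  -- The boundary condition at `b` gives the form the sign of `-Δ₀`.
  have hR0 : mu.im * (dz (-P.b) * conj (z (-P.b))).im ≤ 0 := by
    set u := z (-P.b)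
    set v := dz (-P.b)
    have hb : (P.α₂₀ + mu * P.α'₂₀) * u + (P.α₂₁ + mu * P.α'₂₁) * v = 0 := h.boundary_right
    obtain ⟨k, hk1, hk2⟩ : ∃ k : ℂ, u = k * (P.α₂₁ + mu * P.α'₂₁) ∧
        v = -(k * (P.α₂₀ + mu * P.α'₂₀)) := by
      by_cases h1 : (P.α₂₁ + mu * P.α'₂₁ : ℂ) = 0
      · have h2 : (P.α₂₀ + mu * P.α'₂₀ : ℂ) ≠ 0 := by
          intro h2
          have : (P.Δ₀ : ℂ) = 0 := by
            rw [Δ₀_eq]; push_cast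
            linear_combination P.α'₂₀ * h1 - P.α'₂₁ * h2
          exact hΔ₀.ne' (by exact_mod_cast this)
        rw [h1, zero_mul, add_zero] at hb
        refine ⟨-v / (P.α₂₀ + mu * P.α'₂₀), ?_, by field_simp⟩
        rw [h1, mul_zero]
        exact (mul_eq_zero.1 hb).resolve_left h2
      · refine ⟨u / (P.α₂₁ + mu * P.α'₂₁), by field_simp, ?_⟩
        field_simp
        linear_combination hb
    have : mu.im * (v * conj u).im = -(mu.im ^ 2 * (k.re ^ 2 + k.im ^ 2) * P.Δ₀) := by
      rw [hk1, hk2, Δ₀_eq]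
      simp only [Complex.mul_im, Complex.mul_re, Complex.conj_re, Complex.conj_im, Complex.neg_re,
        Complex.neg_im, Complex.add_re, Complex.add_im, Complex.ofReal_re, Complex.ofReal_im]
      ring
    rw [this]
    have := hΔ₀.le
    exact neg_nonpos.2 (by positivity)
  have hL := h.left.limit_le h.tendsto_y h.tendsto_dy P.a ⟨le_rfl, hac⟩
  have hR := h.right.limit_le h.tendsto_z h.tendsto_dz (-P.b) ⟨le_rfl, hbc⟩
  rw [hL0, mul_zero] at hL
  have htr : P.Δ₁₂ * (dym * conj ym).im + P.Δ₃₄ * (dzm * conj zm).im = 0 := by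
    have r1 := congrArg Complex.re h.transmission₁
    have i1 := congrArg Complex.im h.transmission₁
    have r2 := congrArg Complex.re h.transmission₂
    have i2 := congrArg Complex.im h.transmission₂
    simp at r1 i1 r2 i2
    rw [Δ₁₂_eq, Δ₃₄_eq]
    simp only [Complex.mul_im, Complex.conj_re, Complex.conj_im]
    linear_combination (P.βm₂₁ * dym.im + P.βm₂₀ * ym.im) * r1 -
      (P.βm₂₁ * dym.re + P.βm₂₀ * ym.re) * i1 - (P.βp₁₁ * dzm.im - P.βp₁₀ * zm.im) * r2 +
      (P.βp₁₁ * dzm.re - P.βp₁₀ * zm.re) * i2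
  have htr' : P.Δ₁₂ * (mu.im * (dym * conj ym).im) + P.Δ₃₄ * (mu.im * (dzm * conj zm).im) = 0 := by
    linear_combination mu.im * htr
  have hA := mul_nonpos_of_nonneg_of_nonpos hΔ₁₂.le hL
  have hB := mul_nonpos_of_nonneg_of_nonpos hΔ₃₄.le (hR.trans hR0)
  have hA0 : mu.im * (dym * conj ym).im = 0 :=
    (mul_eq_zero.1 (show P.Δ₁₂ * _ = 0 by linarith)).resolve_left hΔ₁₂.ne'
  have hB0 : mu.im * (dzm * conj zm).im = 0 :=
    (mul_eq_zero.1 (show P.Δ₃₄ * _ = 0 by linarith)).resolve_left hΔ₃₄.ne'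
  rcases hne with ⟨x, hx, hne⟩ | ⟨x, hx, hne⟩
  · refine hne (h.left.eq_zero_of_le_limit hac hmu h.tendsto_y h.tendsto_dy ?_ x hx)
    rw [hL0, mul_zero, hA0]
  · refine hne (h.right.eq_zero_of_le_limit hbc hmu h.tendsto_z h.tendsto_dz ?_ x hx)
    rw [hB0]
    exact hR0

end TransmissionProblem

/-! ### The eigenvalue condition as a condition on the sum of two angles -/

section

variable {Q : ℝ → ℝ} {lam x₀ x₁ : ℝ} {φ dφ : ℝ → ℝ}

theorem IsRealSolution.isHalfSolution_const_mul (h : IsRealSolution Q lam x₀ x₁ φ dφ) (k : ℂ) :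
    IsHalfSolution Q lam x₀ x₁ (fun x => k * φ x) (fun x => k * dφ x) := by
  refine ⟨fun x hx => ?_, fun x hx => ?_⟩
  · exact ((h.deriv_fst x (Ico_subset_Icc_self hx)).ofReal_comp.const_mul k).hasDerivWithinAt
  · refine (((h.deriv_snd x (Ico_subset_Icc_self hx)).ofReal_comp.const_mul k).congr_deriv
      ?_).hasDerivWithinAt
    push_cast
    ring

theorem IsRealSolution.exists_ne_zero (h : IsRealSolution Q lam x₀ x₁ φ dφ) (hx : x₀ < x₁) :
    ∃ x ∈ Ico x₀ x₁, φ x ≠ 0 := by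
  by_contra! hcon
  have hmid : (x₀ + x₁) / 2 ∈ Ioo x₀ x₁ := ⟨by linarith, by linarith⟩
  set z := (x₀ + x₁) / 2
  have hev : φ =ᶠ[𝓝 z] fun _ => 0 := by
    filter_upwards [Ioo_mem_nhds hmid.1 hmid.2] with t ht using hcon t (Ioo_subset_Ico_self ht)
  have h1 := (h.deriv_fst z (Ioo_subset_Icc_self hmid)).unique
    ((hasDerivAt_const z (0 : ℝ)).congr_of_eventuallyEq hev)
  have := h.ne_zero z
  rw [h1, hcon z (Ioo_subset_Ico_self hmid)] at this
  norm_num at this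

theorem IsRealSolution.tendsto_const_mul (h : IsRealSolution Q lam x₀ x₁ φ dφ) (k : ℂ) :
    Tendsto (fun x => k * φ x) (𝓝[<] x₁) (𝓝 (k * φ x₁)) ∧
      Tendsto (fun x => k * dφ x) (𝓝[<] x₁) (𝓝 (k * dφ x₁)) := by
  have h1 := h.continuous_fst
  have h2 := h.continuous_snd
  constructor
  · exact (Continuous.tendsto (f := fun x => k * (φ x : ℂ)) (by fun_prop) x₁).mono_left
      nhdsWithin_le_nhds
  · exact (Continuous.tendsto (f := fun x => k * (dφ x : ℂ)) (by fun_prop) x₁).mono_left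
      nhdsWithin_le_nhds

end

theorem exists_ne_zero_of_det_eq_zero {p₁ p₂ q₁ q₂ : ℝ} (h : p₁ * q₂ - p₂ * q₁ = 0) :
    ∃ k l : ℝ, (k ≠ 0 ∨ l ≠ 0) ∧ k * p₁ + l * q₁ = 0 ∧ k * p₂ + l * q₂ = 0 := by
  by_cases h1 : p₁ = 0
  · by_cases h2 : p₂ = 0
    · exact ⟨1, 0, Or.inl one_ne_zero, by simp [h1], by simp [h2]⟩
    · exact ⟨q₂, -p₂, Or.inr (neg_ne_zero.2 h2), by linarith, by ring⟩
  · exact ⟨q₁, -p₁, Or.inr (neg_ne_zero.2 h1), by ring, by linarith⟩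

/-- Two vectors annihilated by the same non-zero row are parallel. -/
theorem mul_eq_mul_of_row {r s u v u' v' : ℂ} (hrs : r ≠ 0 ∨ s ≠ 0) (h : r * u + s * v = 0)
    (h' : r * u' + s * v' = 0) : u * v' = v * u' := by
  rcases hrs with hr | hs
  · apply mul_left_cancel₀ hr
    linear_combination v' * h - v * h'
  · apply mul_left_cancel₀ hs
    linear_combination u * h' - u' * h

namespace TransmissionProblem

/-- The scale `κ` of the Prüfer angles, with `κ² = Δ₁₂ Δ₃₄ / Δ₂₄²`. -/
noncomputable def kappa (P : TransmissionProblem) : ℝ := Real.sqrt (P.Δ₁₂ * P.Δ₃₄) / |P.Δ₂₄|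

/-- The shear of the left Prüfer angle, `Δ₁₄ / Δ₂₄`. -/
noncomputable def shearLeft (P : TransmissionProblem) : ℝ := P.minor 0 3 / P.Δ₂₄

/-- The shear of the right Prüfer angle, `-Δ₂₃ / Δ₂₄`; the sign comes from the reflection of the
right half. -/
noncomputable def shearRight (P : TransmissionProblem) : ℝ := -P.minor 1 2 / P.Δ₂₄

variable {P : TransmissionProblem}

theorem kappa_pos (hΔ₁₂ : 0 < P.Δ₁₂) (hΔ₃₄ : 0 < P.Δ₃₄) (hΔ₂₄ : P.Δ₂₄ ≠ 0) : 0 < P.kappa :=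
  div_pos (Real.sqrt_pos.2 (mul_pos hΔ₁₂ hΔ₃₄)) (abs_pos.2 hΔ₂₄)

theorem kappa_sq (hΔ₁₂ : 0 < P.Δ₁₂) (hΔ₃₄ : 0 < P.Δ₃₄) :
    P.kappa ^ 2 = P.Δ₁₂ * P.Δ₃₄ / P.Δ₂₄ ^ 2 := by
  rw [kappa, div_pow, Real.sq_sqrt (mul_pos hΔ₁₂ hΔ₃₄).le, sq_abs]

/-- The determinant of the two transmission conditions, for `(φ, dφ)` on the left and `(χ, dχ)`
on the reflected right; by the Plücker relation between the minors it is, up to the factor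
`-Δ₂₄`, of the form `w w' - u u'` in the sheared and scaled coordinates. -/
theorem transmission_det (hΔ₁₂ : 0 < P.Δ₁₂) (hΔ₃₄ : 0 < P.Δ₃₄) (hΔ₂₄ : P.Δ₂₄ ≠ 0)
    (φ dφ χ dχ : ℝ) :
    (P.βm₁₁ * dφ + P.βm₁₀ * φ) * (-P.βp₂₁ * dχ + P.βp₂₀ * χ) -
      (P.βm₂₁ * dφ + P.βm₂₀ * φ) * (-P.βp₁₁ * dχ + P.βp₁₀ * χ) =
    -P.Δ₂₄ * ((dφ + P.shearLeft * φ) * (dχ + P.shearRight * χ) -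
      (P.kappa * φ) * (P.kappa * χ)) := by
  have hk : (P.kappa * φ) * (P.kappa * χ) = P.Δ₁₂ * P.Δ₃₄ / P.Δ₂₄ ^ 2 * (φ * χ) := by
    rw [← kappa_sq hΔ₁₂ hΔ₃₄]; ring
  have h13 : P.minor 0 3 = P.βm₁₀ * P.βp₂₁ - P.βp₁₁ * P.βm₂₀ := by simp [minor_eq, A]
  have h12 : P.minor 1 2 = P.βm₁₁ * P.βp₂₀ - P.βp₁₀ * P.βm₂₁ := by simp [minor_eq, A]
  rw [hk, shearLeft, shearRight]
  field_simp
  rw [h13, h12, Δ₁₂_eq, Δ₃₄_eq, Δ₂₄_eq]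
  ring

theorem right_row_ne_zero (hΔ₀ : 0 < P.Δ₀) (lam : ℝ) :
    P.α₂₀ + lam * P.α'₂₀ ≠ 0 ∨ P.α₂₁ + lam * P.α'₂₁ ≠ 0 := by
  by_contra! h
  have : P.Δ₀ = 0 := by
    rw [Δ₀_eq]
    linear_combination P.α'₂₀ * h.2 - P.α'₂₁ * h.1
  exact hΔ₀.ne' this

theorem isEigenvalue_iff_cos_eq_zero {Q₁ Q₂ Θ₁ Θ₂ : ℝ → ℝ} {lam : ℝ}
    (hac : P.a < P.c) (hcb : P.c < P.b)
    (hα : P.α₁₀ ≠ 0 ∨ P.α₁₁ ≠ 0)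
    (hΔ₀ : 0 < P.Δ₀) (hΔ₁₂ : 0 < P.Δ₁₂) (hΔ₃₄ : 0 < P.Δ₃₄) (hΔ₂₄ : P.Δ₂₄ ≠ 0)
    (hQ₁c : Continuous Q₁) (hQ₂c : Continuous Q₂)
    (hQ₁ : ∀ x ∈ Ico P.a P.c, Q₁ x = P.q x) (hQ₂ : ∀ x ∈ Ico (-P.b) (-P.c), Q₂ x = P.q (-x))
    (hΘ₁ : IsPrueferAngle P.kappa (-P.shearLeft)
      (fun x => (lam - Q₁ x + P.shearLeft ^ 2) / P.kappa) P.a P.c Θ₁)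
    (hΘ₂ : IsPrueferAngle P.kappa (-P.shearRight)
      (fun x => (lam - Q₂ x + P.shearRight ^ 2) / P.kappa) (-P.b) (-P.c) Θ₂)
    (h₁ : P.kappa * P.α₁₁ * Real.cos (Θ₁ P.a) =
      (-P.α₁₀ + P.shearLeft * P.α₁₁) * Real.sin (Θ₁ P.a))
    (h₂ : P.kappa * (P.α₂₁ + lam * P.α'₂₁) * Real.cos (Θ₂ (-P.b)) =
      (-(P.α₂₀ + lam * P.α'₂₀) + P.shearRight * (P.α₂₁ + lam * P.α'₂₁)) *
        Real.sin (Θ₂ (-P.b))) :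
    P.IsEigenvalue lam ↔ Real.cos (Θ₁ P.c + Θ₂ (-P.c)) = 0 := by
  have hκ := kappa_pos hΔ₁₂ hΔ₃₄ hΔ₂₄
  have hbc : -P.b < -P.c := neg_lt_neg hcb
  obtain ⟨φ, dφ, ρ₁, hφ, e₁⟩ := hΘ₁.exists_isRealSolution hκ hQ₁c
  obtain ⟨χ, dχ, ρ₂, hχ, e₂⟩ := hΘ₂.exists_isRealSolution hκ hQ₂c
  have bl : P.α₁₀ * φ P.a + P.α₁₁ * dφ P.a = 0 := by
    obtain ⟨-, i1, i2⟩ := e₁ P.a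
    apply mul_left_cancel₀ hκ.ne'
    linear_combination ρ₁ P.a * h₁ - (-P.α₁₀ + P.shearLeft * P.α₁₁) * i1 + P.kappa * P.α₁₁ * i2
  have br : (P.α₂₀ + lam * P.α'₂₀) * χ (-P.b) + (P.α₂₁ + lam * P.α'₂₁) * dχ (-P.b) = 0 := by
    obtain ⟨-, i1, i2⟩ := e₂ (-P.b)
    apply mul_left_cancel₀ hκ.ne'
    linear_combination ρ₂ (-P.b) * h₂ -
      (-(P.α₂₀ + lam * P.α'₂₀) + P.shearRight * (P.α₂₁ + lam * P.α'₂₁)) * i1 +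
      P.kappa * (P.α₂₁ + lam * P.α'₂₁) * i2
  set p₁ := P.βm₁₁ * dφ P.c + P.βm₁₀ * φ P.c with hp₁
  set p₂ := P.βm₂₁ * dφ P.c + P.βm₂₀ * φ P.c with hp₂
  set q₁ := -P.βp₁₁ * dχ (-P.c) + P.βp₁₀ * χ (-P.c) with hq₁
  set q₂ := -P.βp₂₁ * dχ (-P.c) + P.βp₂₀ * χ (-P.c) with hq₂
  have hdet : p₁ * q₂ - p₂ * q₁ =
      -P.Δ₂₄ * (ρ₁ P.c * ρ₂ (-P.c) * Real.cos (Θ₁ P.c + Θ₂ (-P.c))) := by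
    rw [hp₁, hp₂, hq₁, hq₂, transmission_det hΔ₁₂ hΔ₃₄ hΔ₂₄, (e₁ P.c).2.1, (e₁ P.c).2.2,
      (e₂ (-P.c)).2.1, (e₂ (-P.c)).2.2, Real.cos_add]
    ring
  have hiff : Real.cos (Θ₁ P.c + Θ₂ (-P.c)) = 0 ↔ p₁ * q₂ - p₂ * q₁ = 0 := by
    rw [hdet]
    simp [hΔ₂₄, (e₁ P.c).1.ne', (e₂ (-P.c)).1.ne']
  rw [hiff]
  constructor
  · intro h
    obtain ⟨y, dy, z, dz, ym, dym, zm, dzm, hp, hne⟩ := h.exists_isHalfPair hQ₁ hQ₂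
    have hα' : (P.α₁₀ : ℂ) ≠ 0 ∨ (P.α₁₁ : ℂ) ≠ 0 := by exact_mod_cast hα
    have hr' : (P.α₂₀ + lam * P.α'₂₀ : ℂ) ≠ 0 ∨ (P.α₂₁ + lam * P.α'₂₁ : ℂ) ≠ 0 := by
      exact_mod_cast right_row_ne_zero hΔ₀ lam
    obtain ⟨k, hk⟩ := hp.left.exists_eq_const_mul hφ hac
      (mul_eq_mul_of_row hα' hp.boundary_left (by exact_mod_cast bl))
    obtain ⟨l, hl⟩ := hp.right.exists_eq_const_mul hχ hbc
      (mul_eq_mul_of_row hr' hp.boundary_right (by exact_mod_cast br))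
    have hIL : Ico P.a P.c ∈ 𝓝[<] P.c := Ico_mem_nhdsLT hac
    have hIR : Ico (-P.b) (-P.c) ∈ 𝓝[<] (-P.c) := Ico_mem_nhdsLT hbc
    have t1 : ym = k * φ P.c := tendsto_nhds_unique hp.tendsto_y
      ((hφ.tendsto_const_mul k).1.congr' (by
        filter_upwards [hIL] with t ht using (hk t ht).1.symm))
    have t2 : dym = k * dφ P.c := tendsto_nhds_unique hp.tendsto_dy
      ((hφ.tendsto_const_mul k).2.congr' (by
        filter_upwards [hIL] with t ht using (hk t ht).2.symm))
    have t3 : zm = l * χ (-P.c) := tendsto_nhds_unique hp.tendsto_z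
      ((hχ.tendsto_const_mul l).1.congr' (by
        filter_upwards [hIR] with t ht using (hl t ht).1.symm))
    have t4 : dzm = l * dχ (-P.c) := tendsto_nhds_unique hp.tendsto_dz
      ((hχ.tendsto_const_mul l).2.congr' (by
        filter_upwards [hIR] with t ht using (hl t ht).2.symm))
    have tr1 : k * p₁ + l * q₁ = 0 := by
      have := hp.transmission₁
      rw [t1, t2, t3, t4] at this
      rw [hp₁, hq₁]; push_cast
      linear_combination this
    have tr2 : k * p₂ + l * q₂ = 0 := by
      have := hp.transmission₂
      rw [t1, t2, t3, t4] at this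
      rw [hp₂, hq₂]; push_cast
      linear_combination this
    have hkl : k ≠ 0 ∨ l ≠ 0 := by
      rcases hne with ⟨x, hx, hne⟩ | ⟨x, hx, hne⟩
      · left; rintro rfl; exact hne (by simp [(hk x hx).1])
      · right; rintro rfl; exact hne (by simp [(hl x hx).1])
    have : ((p₁ * q₂ - p₂ * q₁ : ℝ) : ℂ) = 0 := by
      push_cast
      rcases hkl with hk0 | hl0
      · apply mul_left_cancel₀ hk0
        linear_combination q₂ * tr1 - q₁ * tr2
      · apply mul_left_cancel₀ hl0
        linear_combination p₁ * tr2 - p₂ * tr1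
    exact_mod_cast this
  · intro h
    obtain ⟨k, l, hkl, tr1, tr2⟩ := exists_ne_zero_of_det_eq_zero h
    refine IsHalfPair.isEigenvalue (Q₁ := Q₁) (Q₂ := Q₂) hac hcb hQ₁ hQ₂
      (y := fun x => k * φ x) (dy := fun x => k * dφ x) (z := fun x => l * χ x)
      (dz := fun x => l * dχ x) (ym := k * φ P.c) (dym := k * dφ P.c) (zm := l * χ (-P.c))
      (dzm := l * dχ (-P.c)) ⟨hφ.isHalfSolution_const_mul k, hχ.isHalfSolution_const_mul l, ?_, ?_,
        (hφ.tendsto_const_mul k).1, (hφ.tendsto_const_mul k).2, (hχ.tendsto_const_mul l).1,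
        (hχ.tendsto_const_mul l).2, ?_, ?_⟩ ?_
    · norm_cast
      linear_combination k * bl
    · norm_cast
      linear_combination l * br
    · norm_cast
      rw [← tr1, hp₁, hq₁]; ring
    · norm_cast
      rw [← tr2, hp₂, hq₂]; ring
    · rcases hkl with hk | hl
      · obtain ⟨x, hx, hne⟩ := hφ.exists_ne_zero hac
        exact Or.inl ⟨x, hx, by simp [hk, hne]⟩
      · obtain ⟨x, hx, hne⟩ := hχ.exists_ne_zero hbc
        exact Or.inr ⟨x, hx, by simp [hl, hne]⟩

end TransmissionProblem

/-! ### Dependence of the angle on the eigenparameter -/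

/-- A family, indexed by the eigenparameter `lam`, of Prüfer angles of `(y' + A y, κ y)` for the
equation `-y'' + Q y = lam y` on `[x₀, x₁]`, with initial angle `β lam`. -/
structure IsAngleFamily (κ A : ℝ) (Q : ℝ → ℝ) (x₀ x₁ : ℝ) (β : ℝ → ℝ) (Θ : ℝ → ℝ → ℝ) : Prop where
  isPrueferAngle : ∀ lam,
    IsPrueferAngle κ (-A) (fun x => (lam - Q x + A ^ 2) / κ) x₀ x₁ (Θ lam)
  initial : ∀ lam, Θ lam x₀ = β lam

theorem exists_isAngleFamily (κ A : ℝ) {Q : ℝ → ℝ} (hQ : Continuous Q) {x₀ x₁ : ℝ} (hx : x₀ < x₁)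
    (β : ℝ → ℝ) : ∃ Θ, IsAngleFamily κ A Q x₀ x₁ β Θ := by
  have h : ∀ lam, ∃ Θ, IsPrueferAngle κ (-A) (fun x => (lam - Q x + A ^ 2) / κ) x₀ x₁ Θ ∧
      Θ x₀ = β lam := fun lam => exists_isPrueferAngle κ (-A) (by fun_prop) hx (β lam)
  choose Θ h1 h2 using h
  exact ⟨Θ, h1, h2⟩

namespace IsAngleFamily

variable {κ A x₀ x₁ : ℝ} {Q β : ℝ → ℝ} {Θ : ℝ → ℝ → ℝ}

theorem strictMono (h : IsAngleFamily κ A Q x₀ x₁ β Θ) (hκ : 0 < κ) (hQ : Continuous Q)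
    (hx : x₀ < x₁) (hβ : Monotone β) : StrictMono fun lam => Θ lam x₁ := by
  intro lam mu hlt
  refine (h.isPrueferAngle lam).lt_of_lt (h.isPrueferAngle mu) (by fun_prop) hκ hx
    (fun x _ => ?_) ?_
  · gcongr
  · rw [h.initial, h.initial]
    exact hβ hlt.le

theorem continuous (h : IsAngleFamily κ A Q x₀ x₁ β Θ) (hκ : 0 < κ) (hQ : Continuous Q)
    (hx : x₀ < x₁) (hβ : Monotone β) (hβc : Continuous β) : Continuous fun lam => Θ lam x₁ := by
  obtain ⟨q, hq⟩ := (isCompact_Icc (a := x₀) (b := x₁)).exists_bound_of_continuousOn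
    hQ.continuousOn
  have hq0 : 0 ≤ q := (norm_nonneg _).trans (hq x₀ ⟨le_rfl, hx.le⟩)
  rw [continuous_iff_continuousAt]
  intro lam₀
  set M := |lam₀| + 1 with hM
  set K := (M + q + A ^ 2) / κ + |κ| + 2 * |-A| with hK
  have hK0 : 0 ≤ K := by positivity
  -- a Lipschitz estimate on `[-M, M]`
  have key : ∀ lam mu, lam ≤ mu → |lam| ≤ M → |mu| ≤ M → |Θ mu x₁ - Θ lam x₁| ≤
      Real.exp (K * (x₁ - x₀)) * (|β mu - β lam| + |mu - lam| / κ * (x₁ - x₀)) := by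
    intro lam mu hle hl hm
    have hmono := (h.strictMono hκ hQ hx hβ).monotone hle
    have h1 := (h.isPrueferAngle lam).sub_le_exp_mul (h.isPrueferAngle mu) (by fun_prop) hx.le
      (K := K) (η := (mu - lam) / κ)
      (fun x _ => by gcongr) (by rw [h.initial, h.initial]; exact hβ hle) hK0
      (div_nonneg (sub_nonneg.2 hle) hκ.le) (fun x _ => by apply le_of_eq; field_simp; ring)
      (fun x hx' => ?_)
    · rw [h.initial, h.initial] at h1
      rw [abs_of_nonneg (sub_nonneg.2 hmono), abs_of_nonneg (sub_nonneg.2 (hβ hle)),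
        abs_of_nonneg (sub_nonneg.2 hle)]
      exact h1
    · rw [hK]
      gcongr
      rw [abs_div, abs_of_pos hκ]
      gcongr
      have := hq x hx'
      rw [Real.norm_eq_abs] at this
      calc |mu - Q x + A ^ 2| ≤ |mu - Q x| + |A ^ 2| := abs_add_le _ _
        _ ≤ |mu| + |Q x| + A ^ 2 := by
          rw [abs_of_nonneg (sq_nonneg A)]
          gcongr
          exact abs_sub _ _
        _ ≤ M + q + A ^ 2 := by gcongr
  have hev : ∀ᶠ lam in 𝓝 lam₀, ‖Θ lam x₁ - Θ lam₀ x₁‖ ≤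
      Real.exp (K * (x₁ - x₀)) * (|β lam - β lam₀| + |lam - lam₀| / κ * (x₁ - x₀)) := by
    filter_upwards [Metric.ball_mem_nhds lam₀ one_pos] with lam hlam
    rw [Metric.mem_ball, Real.dist_eq] at hlam
    have h1 : |lam| ≤ M := by
      have := abs_sub_abs_le_abs_sub lam lam₀
      rw [hM]; linarith
    have h2 : |lam₀| ≤ M := by rw [hM]; linarith
    rw [Real.norm_eq_abs]
    rcases le_total lam lam₀ with hle | hle
    · have := key lam lam₀ hle h1 h2
      rwa [abs_sub_comm, abs_sub_comm (β lam), abs_sub_comm lam]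
    · exact key lam₀ lam hle h2 h1
  have hlim : Tendsto (fun lam => Real.exp (K * (x₁ - x₀)) *
      (|β lam - β lam₀| + |lam - lam₀| / κ * (x₁ - x₀))) (𝓝 lam₀) (𝓝 0) := by
    have : Continuous fun lam => Real.exp (K * (x₁ - x₀)) *
      (|β lam - β lam₀| + |lam - lam₀| / κ * (x₁ - x₀)) := by fun_prop
    simpa using this.tendsto lam₀
  exact tendsto_sub_nhds_zero_iff.1 (squeeze_zero_norm' hev hlim)

theorem tendsto_atBot (h : IsAngleFamily κ A Q x₀ x₁ β Θ) (hκ : 0 < κ) (hQ : Continuous Q)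
    (hx : x₀ < x₁) (hβ : ∀ lam, 0 ≤ β lam) {δ : ℝ} (hδ : 0 < δ)
    (hβ' : ∀ᶠ lam in atBot, β lam ≤ Real.pi - δ) :
    Tendsto (fun lam => Θ lam x₁) atBot (𝓝 0) := by
  obtain ⟨q, hq⟩ := (isCompact_Icc (a := x₀) (b := x₁)).exists_bound_of_continuousOn
    hQ.continuousOn
  have h0 : ∀ lam, 0 ≤ Θ lam x₁ := fun lam =>
    (h.isPrueferAngle lam).nonneg hκ hx.le (by rw [h.initial]; exact hβ lam)
  rw [Metric.tendsto_nhds]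
  intro ε₀ hε₀
  obtain ⟨ε, hε, hεlt⟩ : ∃ ε > 0, ε < min (min ε₀ δ) (Real.pi / 2) :=
    exists_between (lt_min (lt_min hε₀ hδ) (by positivity))
  have hs : 0 < Real.sin ε := Real.sin_pos_of_pos_of_lt_pi hε
    (by linarith [hεlt.trans_le (min_le_right _ _), Real.pi_pos])
  set B := -(|κ| + 2 * |-A|) - (Real.pi - 2 * ε) / (x₁ - x₀) with hB
  filter_upwards [hβ', eventually_lt_atBot (κ * (B / Real.sin ε ^ 2) - q - A ^ 2),
    eventually_lt_atBot (-q - A ^ 2)] with lam h1 h2 h3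
  have hε2 : ε < Real.pi / 2 := hεlt.trans_le (min_le_right _ _)
  have hle : Θ lam x₁ ≤ ε := by
    refine (h.isPrueferAngle lam).le_of_barrier hx hε hε2 ?_ (fun x hx' => ?_) (fun x hx' => ?_)
    · rw [h.initial]
      have : ε < δ := hεlt.trans_le ((min_le_left _ _).trans (min_le_right _ _))
      linarith
    · have := (abs_le.1 (hq x hx')).1
      rw [← hB, ← lt_div_iff₀ (by positivity), div_lt_iff₀ hκ]
      linarith
    · have := (abs_le.1 (hq x hx')).1
      exact div_nonpos_of_nonpos_of_nonneg (by linarith) hκ.le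
  rw [Real.dist_eq, sub_zero, abs_of_nonneg (h0 lam)]
  exact hle.trans_lt (hεlt.trans_le ((min_le_left _ _).trans (min_le_left _ _)))

end IsAngleFamily

/-! ### Asymptotics of the angle for large eigenparameter -/

/-- The angles `Θ` of `(y' + A y, κ y)` and `ψ` of `(y', s y)` belong, modulo `π`, to the same
vector `(y', y)`. -/
def PhaseRel (κ A s Θ ψ : ℝ) : Prop :=
  s * Real.sin Θ * Real.cos ψ = (κ * Real.cos Θ - A * Real.sin Θ) * Real.sin ψ

section Phase

variable {κ A s Θ ψ : ℝ}

theorem PhaseRel.form_pos (hκ : 0 < κ) (hs : A ^ 2 < 4 * κ * s) (Θ : ℝ) :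
    0 < κ * Real.cos Θ ^ 2 - A * (Real.sin Θ * Real.cos Θ) + s * Real.sin Θ ^ 2 := by
  have h1 := Real.sin_sq_add_cos_sq Θ
  have hs0 : 0 < s := by nlinarith [sq_nonneg A]
  have e : 4 * κ * (κ * Real.cos Θ ^ 2 - A * (Real.sin Θ * Real.cos Θ) + s * Real.sin Θ ^ 2) =
      (2 * κ * Real.cos Θ - A * Real.sin Θ) ^ 2 + (4 * κ * s - A ^ 2) * Real.sin Θ ^ 2 := by ring
  have hpos : 0 < (2 * κ * Real.cos Θ - A * Real.sin Θ) ^ 2 +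
      (4 * κ * s - A ^ 2) * Real.sin Θ ^ 2 := by
    by_cases h : Real.sin Θ = 0
    · have hc : Real.cos Θ ^ 2 = 1 := by rw [h] at h1; linarith
      have : (2 * κ * Real.cos Θ - A * Real.sin Θ) ^ 2 = 4 * κ ^ 2 := by
        rw [h]; linear_combination 4 * κ ^ 2 * hc
      rw [this, h]; positivity
    · have := mul_pos (sub_pos.2 hs) (by positivity : 0 < Real.sin Θ ^ 2)
      positivity
  rw [← e] at hpos
  exact pos_of_mul_pos_right hpos (by positivity)

theorem PhaseRel.exists (hκ : 0 < κ) (hs : A ^ 2 < 4 * κ * s) (Θ : ℝ) :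
    ∃ ψ, |ψ - Θ| < Real.pi / 2 ∧ PhaseRel κ A s Θ ψ := by
  have hD := PhaseRel.form_pos hκ hs Θ
  set D := κ * Real.cos Θ ^ 2 - A * (Real.sin Θ * Real.cos Θ) + s * Real.sin Θ ^ 2 with hDdef
  set N := s * Real.sin Θ * Real.cos Θ - (κ * Real.cos Θ - A * Real.sin Θ) * Real.sin Θ with hN
  refine ⟨Θ + Real.arctan (N / D), ?_, ?_⟩
  · rw [add_sub_cancel_left, abs_lt]
    exact ⟨Real.neg_pi_div_two_lt_arctan _, Real.arctan_lt_pi_div_two _⟩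
  · unfold PhaseRel
    rw [Real.cos_add, Real.sin_add]
    have ht : Real.sin (Real.arctan (N / D)) = N / D * Real.cos (Real.arctan (N / D)) := by
      have := Real.tan_arctan (N / D)
      rw [Real.tan_eq_sin_div_cos, div_eq_iff (Real.cos_arctan_pos _).ne'] at this
      exact this
    have hND : N / D * D = N := div_mul_cancel₀ _ hD.ne'
    rw [ht]
    rw [hDdef, hN] at hND
    linear_combination -Real.cos (Real.arctan (N / D)) * hND

theorem PhaseRel.cos_sub_ne_zero (h : PhaseRel κ A s Θ ψ) (hκ : 0 < κ)
    (hs : A ^ 2 < 4 * κ * s) : Real.cos (ψ - Θ) ≠ 0 := by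
  intro hc
  have hD := PhaseRel.form_pos hκ hs Θ
  have hψ : ψ = Θ + (ψ - Θ) := by ring
  set η := ψ - Θ
  have hsin : Real.sin η ≠ 0 := by
    intro h0
    have := Real.sin_sq_add_cos_sq η
    rw [h0, hc] at this
    norm_num at this
  unfold PhaseRel at h
  rw [hψ, Real.cos_add, Real.sin_add, hc] at h
  have : Real.sin η *
      (κ * Real.cos Θ ^ 2 - A * (Real.sin Θ * Real.cos Θ) + s * Real.sin Θ ^ 2) = 0 := by
    linear_combination -h
  rcases mul_eq_zero.1 this with h' | h'
  · exact hsin h'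
  · exact hD.ne' h'

theorem PhaseRel.sub_int_mul_pi (h : PhaseRel κ A s Θ ψ) (n : ℤ) :
    PhaseRel κ A s (Θ - n * Real.pi) (ψ - n * Real.pi) := by
  unfold PhaseRel at *
  rw [Real.sin_sub_int_mul_pi, Real.cos_sub_int_mul_pi, Real.sin_sub_int_mul_pi,
    Real.cos_sub_int_mul_pi]
  linear_combination ((-1) ^ n * (-1) ^ n) * h

theorem PhaseRel.pi_sub (h : PhaseRel κ A s Θ ψ) :
    PhaseRel κ (-A) s (Real.pi - Θ) (Real.pi - ψ) := by
  unfold PhaseRel at *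
  rw [Real.sin_pi_sub, Real.cos_pi_sub, Real.sin_pi_sub, Real.cos_pi_sub]
  linear_combination -h

/-- The case `n = 0` of `PhaseRel.three_pi_div_four_le`: if `Θ < 3 π / 4`, then `cot Θ > -1`, so
`s cos ψ = (κ cot Θ - A) sin ψ` cannot be as negative as the lower bound on `ψ` makes it. -/
theorem PhaseRel.three_pi_div_four_le_aux (h : PhaseRel κ A s Θ ψ) (hκ : 0 < κ)
    (hs : 2 * (κ + |A|) ≤ s) (hψΘ : |ψ - Θ| < Real.pi / 2)
    (hψ : Real.pi / 2 + 2 * (κ + |A|) / s ≤ ψ) : 3 * Real.pi / 4 ≤ Θ := by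
  by_contra! hΘ
  have hX : 0 < κ + |A| := by positivity
  have hs0 : 0 < s := by linarith
  have hπ := Real.pi_pos
  have hKs : 0 < 2 * (κ + |A|) / s := by positivity
  obtain ⟨hlo, hhi⟩ := abs_lt.1 hψΘ
  have hS : 0 < Real.sin Θ := Real.sin_pos_of_pos_of_lt_pi (by linarith) (by linarith)
  have hcs : 0 < Real.sin Θ + Real.cos Θ := by
    have := Real.sin_pos_of_pos_of_lt_pi (x := Θ + Real.pi / 4) (by linarith) (by linarith)
    rw [Real.sin_add, Real.cos_pi_div_four, Real.sin_pi_div_four] at this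
    have h2 : 0 < Real.sqrt 2 / 2 := by positivity
    have e : Real.sin Θ * (Real.sqrt 2 / 2) + Real.cos Θ * (Real.sqrt 2 / 2) =
      (Real.sin Θ + Real.cos Θ) * (Real.sqrt 2 / 2) := by ring
    rw [e] at this
    exact pos_of_mul_pos_left this h2.le
  have hA := abs_le.1 (le_refl |A|)
  have hAS1 : A * Real.sin Θ ≤ |A| * Real.sin Θ := by gcongr; exact hA.2
  have hAS2 : -(|A| * Real.sin Θ) ≤ A * Real.sin Θ := by
    have := mul_le_mul_of_nonneg_right hA.1 hS.le
    linarith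
  have hlow : -((κ + |A|) * Real.sin Θ) ≤ κ * Real.cos Θ - A * Real.sin Θ := by
    have := mul_pos hκ hcs
    linarith
  have hXS : 0 < (κ + |A|) * Real.sin Θ := mul_pos hX hS
  unfold PhaseRel at h
  rcases le_total ψ Real.pi with hψπ | hψπ
  · have hsψ0 : 0 ≤ Real.sin ψ := Real.sin_nonneg_of_nonneg_of_le_pi (by linarith) hψπ
    have hsψ1 := Real.sin_le_one ψ
    have hjordan : 2 / Real.pi * (ψ - Real.pi / 2) ≤ Real.sin (ψ - Real.pi / 2) :=
      Real.mul_le_sin (by linarith) (by linarith)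
    rw [Real.sin_sub_pi_div_two] at hjordan
    have hlt : (κ + |A|) < -(s * Real.cos ψ) := by
      have h1 : 2 / Real.pi * (2 * (κ + |A|) / s) ≤ -Real.cos ψ :=
        le_trans (by gcongr; linarith) hjordan
      have h2 : s * (2 / Real.pi * (2 * (κ + |A|) / s)) ≤ s * -Real.cos ψ := by gcongr
      have h3 : s * (2 / Real.pi * (2 * (κ + |A|) / s)) = 4 / Real.pi * (κ + |A|) := by
        field_simp; ring
      have h4 : 1 < 4 / Real.pi := (one_lt_div hπ).2 Real.pi_lt_four
      have h5 : (κ + |A|) < 4 / Real.pi * (κ + |A|) := lt_mul_of_one_lt_left hX h4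
      linarith
    have h6 := mul_lt_mul_of_pos_right hlt hS
    have h7 := mul_le_mul_of_nonneg_right hlow hsψ0
    have h8 : (κ + |A|) * Real.sin Θ * Real.sin ψ ≤ (κ + |A|) * Real.sin Θ :=
      mul_le_of_le_one_right hXS.le hsψ1
    linarith
  · have hcΘ : Real.cos Θ ≤ 0 :=
      Real.cos_nonpos_of_pi_div_two_le_of_le (by linarith) (by linarith)
    have hup : κ * Real.cos Θ - A * Real.sin Θ ≤ (κ + |A|) * Real.sin Θ := by
      have := mul_nonpos_of_nonneg_of_nonpos hκ.le hcΘ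
      have := mul_pos hκ hS
      linarith
    have hcψ : Real.cos ψ < -(1 / 2) := by
      have h1 : Real.cos (Real.pi / 3) < Real.cos (ψ - Real.pi) :=
        Real.cos_lt_cos_of_nonneg_of_le_pi (by linarith) (by linarith) (by linarith)
      rw [Real.cos_sub_pi, Real.cos_pi_div_three] at h1
      linarith
    have habs : |(κ * Real.cos Θ - A * Real.sin Θ) * Real.sin ψ| ≤ (κ + |A|) * Real.sin Θ := by
      rw [abs_mul]
      exact (mul_le_of_le_one_right (abs_nonneg _) (Real.abs_sin_le_one ψ)).trans
        (abs_le.2 ⟨hlow, hup⟩)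
    rw [← h] at habs
    have h1 := (abs_le.1 habs).1
    have h2 : (κ + |A|) * Real.sin Θ < s * Real.sin Θ * -Real.cos ψ := by
      have : (κ + |A|) < s * -Real.cos ψ := by
        have := mul_lt_mul_of_pos_left hcψ hs0
        linarith
      have := mul_lt_mul_of_pos_right this hS
      linarith
    linarith

/-- For large `s`, the angle `Θ` rises from below `n π + π / 4` to above `n π + 3 π / 4` while
`ψ` passes through a neighbourhood of `(n + 1/2) π` of size `O(1/s)`; this is the upper half. -/
theorem PhaseRel.three_pi_div_four_le (h : PhaseRel κ A s Θ ψ) (hκ : 0 < κ)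
    (hs : 2 * (κ + |A|) ≤ s) (hψΘ : |ψ - Θ| < Real.pi / 2) (n : ℤ)
    (hψ : (n + 1 / 2) * Real.pi + 2 * (κ + |A|) / s ≤ ψ) :
    n * Real.pi + 3 * Real.pi / 4 ≤ Θ := by
  have := (h.sub_int_mul_pi n).three_pi_div_four_le_aux hκ hs (by simpa using hψΘ) (by linarith)
  linarith

theorem PhaseRel.le_pi_div_four (h : PhaseRel κ A s Θ ψ) (hκ : 0 < κ)
    (hs : 2 * (κ + |A|) ≤ s) (hψΘ : |ψ - Θ| < Real.pi / 2) (n : ℤ)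
    (hψ : ψ ≤ (n + 1 / 2) * Real.pi - 2 * (κ + |A|) / s) :
    Θ ≤ n * Real.pi + Real.pi / 4 := by
  have := (h.sub_int_mul_pi n).pi_sub.three_pi_div_four_le_aux hκ (by simpa using hs)
    (by rw [abs_sub_comm]; simpa using hψΘ) (by rw [abs_neg]; linarith)
  linarith

/-- If `Θ` stays away from the multiples of `π`, then `ψ` is `O(1/s)`-close to an odd multiple
of `π / 2`. -/
theorem PhaseRel.abs_sub_le {η : ℝ} (h : PhaseRel κ A s Θ ψ) (hκ : 0 < κ) (hs : 0 < s)
    (hη : 0 < η) (hψΘ : |ψ - Θ| < Real.pi / 2) (n : ℤ) (h1 : n * Real.pi + η ≤ Θ)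
    (h2 : Θ ≤ n * Real.pi + Real.pi - η) :
    |ψ - (n * Real.pi + Real.pi / 2)| ≤ Real.pi * (κ + |A|) / Real.sin η ^ 2 / s := by
  have h' := h.sub_int_mul_pi n
  have hψΘ' : |(ψ - n * Real.pi) - (Θ - n * Real.pi)| < Real.pi / 2 := by simpa using hψΘ
  have e : ψ - (n * Real.pi + Real.pi / 2) = (ψ - n * Real.pi) - Real.pi / 2 := by ring
  rw [e]
  have h1' : η ≤ Θ - n * Real.pi := by linarith
  have h2' : Θ - n * Real.pi ≤ Real.pi - η := by linarith
  generalize ψ - n * Real.pi = ψ at *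
  generalize Θ - n * Real.pi = Θ at *
  have hπ := Real.pi_pos
  obtain ⟨hlo, hhi⟩ := abs_lt.1 hψΘ'
  have hση : 0 < Real.sin η := Real.sin_pos_of_pos_of_lt_pi hη (by linarith)
  -- `sin` is at least `sin η` on `[η, π - η]`
  have hsin : ∀ t, η ≤ t → t ≤ Real.pi - η → Real.sin η ≤ Real.sin t := by
    intro t ht1 ht2
    rcases le_total t (Real.pi / 2) with h' | h'
    · exact Real.sin_le_sin_of_le_of_le_pi_div_two (by linarith) h' ht1
    · rw [← Real.sin_pi_sub t]
      exact Real.sin_le_sin_of_le_of_le_pi_div_two (by linarith) (by linarith) (by linarith)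
  have hS := hsin Θ h1' h2'
  -- `|sin t| ≥ (sin η / π) |t|` for `|t| ≤ π - η`
  have hlin : ∀ t, 0 ≤ t → t ≤ Real.pi - η → Real.sin η / Real.pi * t ≤ Real.sin t := by
    intro t ht0 ht1
    rcases le_total t (Real.pi / 2) with h' | h'
    · refine le_trans ?_ (Real.mul_le_sin ht0 h')
      gcongr
      linarith [Real.sin_le_one η]
    · refine le_trans ?_ (hsin t (by linarith) ht1)
      rw [div_mul_eq_mul_div, div_le_iff₀ hπ]
      gcongr
      linarith
  have hcos : |Real.cos ψ| ≤ (κ + |A|) / (s * Real.sin η) := by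
    rw [le_div_iff₀ (by positivity)]
    have e1 : |s * Real.sin Θ * Real.cos ψ| ≤ κ + |A| := by
      rw [h', abs_mul]
      refine (mul_le_of_le_one_right (abs_nonneg _) (Real.abs_sin_le_one ψ)).trans ?_
      refine (abs_sub _ _).trans ?_
      rw [abs_mul, abs_mul, abs_of_pos hκ]
      exact add_le_add (mul_le_of_le_one_right hκ.le (Real.abs_cos_le_one _))
        (mul_le_of_le_one_right (abs_nonneg _) (Real.abs_sin_le_one _))
    rw [abs_mul, abs_of_pos (mul_pos hs (hση.trans_le hS))] at e1
    refine le_trans ?_ e1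
    rw [mul_comm]
    gcongr
  have hle : Real.sin η / Real.pi * |ψ - Real.pi / 2| ≤ |Real.cos ψ| := by
    have e2 : Real.cos ψ = -Real.sin (ψ - Real.pi / 2) := by rw [Real.sin_sub_pi_div_two]; ring
    rw [e2, abs_neg]
    rcases le_total 0 (ψ - Real.pi / 2) with h0 | h0
    · rw [abs_of_nonneg h0]
      exact (hlin _ h0 (by linarith)).trans (le_abs_self _)
    · rw [abs_of_nonpos h0, ← abs_neg (Real.sin _), ← Real.sin_neg]
      exact (hlin _ (by linarith) (by linarith)).trans (le_abs_self _)
  have hfin := hle.trans hcos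
  rw [div_mul_eq_mul_div, div_le_iff₀ hπ] at hfin
  have : |ψ - Real.pi / 2| ≤ ((κ + |A|) / (s * Real.sin η) * Real.pi) / Real.sin η := by
    rw [le_div_iff₀ hση]; linarith
  refine this.trans (le_of_eq ?_)
  field_simp

end Phase

/-- The angle `ψ` of `(y', s y)` at the initial point, where the angle of `(y' + A y, κ y)` is
`β (s ^ 2)`, is `θ₀ + O(1/s)` as `s → ∞`. -/
def HasInitialPhase (κ A : ℝ) (β : ℝ → ℝ) (θ₀ : ℝ) : Prop :=
  ∃ K s₀ : ℝ, ∀ s, s₀ ≤ s → ∀ ψ, |ψ - β (s ^ 2)| < Real.pi / 2 →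
    PhaseRel κ A s (β (s ^ 2)) ψ → |ψ - θ₀| ≤ K / s

theorem hasInitialPhase_zero {κ : ℝ} (hκ : 0 < κ) (A : ℝ) :
    HasInitialPhase κ A (fun _ => 0) 0 := by
  refine ⟨0, 0, fun s _ ψ hψ h => ?_⟩
  simp only [PhaseRel, Real.sin_zero, Real.cos_zero] at h
  have hs : Real.sin ψ = 0 := by simpa [hκ.ne'] using h.symm
  rw [sub_zero] at hψ
  obtain ⟨h1, h2⟩ := abs_lt.1 hψ
  have hπ := Real.pi_pos
  have : ψ = 0 := (Real.sin_eq_zero_iff_of_lt_of_lt (by linarith) (by linarith)).1 hs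
  simp [this]

theorem hasInitialPhase_of_mem {κ : ℝ} (hκ : 0 < κ) (A : ℝ) {β : ℝ → ℝ} {η : ℝ} (hη : 0 < η)
    (n : ℤ) (h : ∀ᶠ lam in atTop, n * Real.pi + η ≤ β lam ∧ β lam ≤ n * Real.pi + Real.pi - η) :
    HasInitialPhase κ A β (n * Real.pi + Real.pi / 2) := by
  have hsq : Tendsto (fun s : ℝ => s ^ 2) atTop atTop := tendsto_pow_atTop two_ne_zero
  obtain ⟨s₀, hs₀⟩ := eventually_atTop.1 ((hsq.eventually h).and (eventually_gt_atTop 0))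
  exact ⟨Real.pi * (κ + |A|) / Real.sin η ^ 2, s₀, fun s hs ψ hψ hrel =>
    hrel.abs_sub_le hκ (hs₀ s hs).2 hη hψ n (hs₀ s hs).1.1 (hs₀ s hs).1.2⟩

/-- An initial angle that tends to `π` like `π - O(1/s²)` has a phase that tends to `π` like
`π - O(1/s)`. -/
theorem hasInitialPhase_arctan {κ : ℝ} (hκ : 0 < κ) (A t₀ : ℝ) {d : ℝ} (hd : 0 < d) :
    HasInitialPhase κ A (fun lam => Real.pi / 2 + Real.arctan ((lam + t₀) / d)) Real.pi := by
  have hπ := Real.pi_pos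
  set c := κ / d / 2 with hc
  have hc0 : 0 < c := by positivity
  -- for large `s`, `κ (s² + t₀) / d + A` is at least half its leading term
  have hev : ∀ᶠ s : ℝ in atTop, c * s ^ 2 ≤ κ * ((s ^ 2 + t₀) / d) + A ∧ 0 ≤ (s ^ 2 + t₀) / d ∧
      0 < s := by
    have hsq : Tendsto (fun s : ℝ => s ^ 2) atTop atTop := tendsto_pow_atTop two_ne_zero
    filter_upwards [hsq.eventually_ge_atTop (-(κ / d * t₀ + A) / c),
      hsq.eventually_ge_atTop (-t₀), eventually_gt_atTop 0] with s h1 h2 h3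
    refine ⟨?_, div_nonneg (by linarith) hd.le, h3⟩
    rw [div_le_iff₀ hc0] at h1
    have e : κ * ((s ^ 2 + t₀) / d) + A = 2 * c * s ^ 2 + (κ / d * t₀ + A) := by
      rw [hc]; field_simp; ring
    rw [e]
    linarith
  obtain ⟨s₀, hs₀⟩ := eventually_atTop.1 hev
  refine ⟨Real.pi / 2 / c, s₀, fun s hs ψ hψ hrel => ?_⟩
  obtain ⟨h1, h2, h3⟩ := hs₀ s hs
  beta_reduce at hψ hrel
  set t := (s ^ 2 + t₀) / d with ht
  have hat0 : 0 ≤ Real.arctan t := Real.arctan_nonneg.2 h2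
  have hat1 := Real.arctan_lt_pi_div_two t
  have hcp := Real.cos_arctan_pos t
  have hts : Real.sin (Real.arctan t) = t * Real.cos (Real.arctan t) := by
    have := Real.tan_arctan t
    rwa [Real.tan_eq_sin_div_cos, div_eq_iff hcp.ne'] at this
  have hrel' : s * Real.cos ψ = -(κ * t + A) * Real.sin ψ := by
    unfold PhaseRel at hrel
    rw [add_comm (Real.pi / 2), Real.sin_add_pi_div_two, Real.cos_add_pi_div_two, hts] at hrel
    apply mul_left_cancel₀ hcp.ne'
    linear_combination hrel
  have hpos : 0 < κ * t + A := lt_of_lt_of_le (by positivity) h1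
  obtain ⟨hlo, hhi⟩ := abs_lt.1 hψ
  have hψ2 : Real.pi / 2 ≤ ψ := by
    by_contra! hcon
    have hs1 : 0 < Real.sin ψ := Real.sin_pos_of_pos_of_lt_pi (by linarith) (by linarith)
    have hc1 : 0 < Real.cos ψ := Real.cos_pos_of_mem_Ioo ⟨by linarith, hcon⟩
    have := mul_pos h3 hc1
    have := mul_pos hpos hs1
    linarith
  have hsin : c * s * |Real.sin ψ| ≤ 1 := by
    have e1 : s * |Real.cos ψ| = (κ * t + A) * |Real.sin ψ| := by
      rw [← abs_of_pos hpos, ← abs_mul, ← abs_neg ((κ * t + A) * _), ← neg_mul, ← hrel', abs_mul,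
        abs_of_pos h3]
    have e2 : c * s ^ 2 * |Real.sin ψ| ≤ s * |Real.cos ψ| := by rw [e1]; gcongr
    have e3 : s * (c * s * |Real.sin ψ|) ≤ s * 1 := by
      have := mul_le_mul_of_nonneg_left (Real.abs_cos_le_one ψ) h3.le
      linarith
    exact le_of_mul_le_mul_left e3 h3
  have hj : 2 / Real.pi * |ψ - Real.pi| ≤ |Real.sin ψ| := by
    have e2 : Real.sin ψ = -Real.sin (ψ - Real.pi) := by rw [Real.sin_sub_pi]; ring
    rw [e2, abs_neg]
    rcases le_total 0 (ψ - Real.pi) with h0 | h0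
    · rw [abs_of_nonneg h0]
      exact (Real.mul_le_sin h0 (by linarith)).trans (le_abs_self _)
    · rw [abs_of_nonpos h0, ← abs_neg (Real.sin _), ← Real.sin_neg]
      exact (Real.mul_le_sin (by linarith) (by linarith)).trans (le_abs_self _)
  have : c * s * (2 / Real.pi * |ψ - Real.pi|) ≤ 1 := le_trans (by gcongr) hsin
  rw [le_div_iff₀ h3, le_div_iff₀ hc0]
  have e : c * s * (2 / Real.pi * |ψ - Real.pi|) * (Real.pi / 2) = |ψ - Real.pi| * s * c := by
    field_simp
  rw [← e]
  exact mul_le_of_le_one_left (by positivity) this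

/-- The angle of `(y', s y)` turns at speed `s - (Q / s) sin²`. -/
theorem IsPrueferAngle.abs_sub_sub_le {s q x₀ x₁ : ℝ} {Q θ : ℝ → ℝ} (hs : 0 < s) (hx : x₀ ≤ x₁)
    (h : IsPrueferAngle s (-0) (fun x => (s ^ 2 - Q x + 0 ^ 2) / s) x₀ x₁ θ)
    (hq : ∀ x ∈ Icc x₀ x₁, ‖Q x‖ ≤ q) :
    |θ x₁ - (θ x₀ + s * (x₁ - x₀))| ≤ q * (x₁ - x₀) / s := by
  have hd : ∀ x ∈ Icc x₀ x₁, HasDerivWithinAt (fun x => θ x - s * x)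
      (-(Q x / s) * Real.sin (θ x) ^ 2) (Icc x₀ x₁) x := fun x hx' => by
    refine (((h.hasDerivAt x hx').fun_sub
      ((hasDerivAt_id x).const_mul s)).congr_deriv ?_).hasDerivWithinAt
    unfold prueferSpeed
    have := Real.cos_sq' (θ x)
    rw [this]
    field_simp
    ring
  have hb : ∀ x ∈ Icc x₀ x₁, ‖-(Q x / s) * Real.sin (θ x) ^ 2‖ ≤ q / s := fun x hx' => by
    rw [norm_mul, norm_neg, norm_div, Real.norm_of_nonneg hs.le,
      Real.norm_of_nonneg (sq_nonneg (Real.sin (θ x)))]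
    refine (mul_le_of_le_one_right (by positivity) (Real.sin_sq_le_one _)).trans ?_
    gcongr
    exact hq x hx'
  have := (convex_Icc x₀ x₁).norm_image_sub_le_of_norm_hasDerivWithin_le hd hb
    (left_mem_Icc.2 hx) (right_mem_Icc.2 hx)
  rw [Real.norm_eq_abs, Real.norm_of_nonneg (sub_nonneg.2 hx)] at this
  calc |θ x₁ - (θ x₀ + s * (x₁ - x₀))| = |θ x₁ - s * x₁ - (θ x₀ - s * x₀)| := by ring_nf
    _ ≤ q / s * (x₁ - x₀) := this
    _ = q * (x₁ - x₀) / s := by ring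

/-- Up to `O(1/s)`, the angle `Θ (s ^ 2) x₁` passes from below `n π + π / 4` to above
`n π + 3 π / 4` when `s (x₁ - x₀) + θ₀` passes `(n + 1/2) π`. -/
theorem IsAngleFamily.exists_phase_bound {κ A x₀ x₁ θ₀ : ℝ} {Q β : ℝ → ℝ} {Θ : ℝ → ℝ → ℝ}
    (h : IsAngleFamily κ A Q x₀ x₁ β Θ) (hκ : 0 < κ) (hQ : Continuous Q) (hx : x₀ < x₁)
    (hβ : HasInitialPhase κ A β θ₀) :
    ∃ K s₀ : ℝ, 0 < K ∧ 0 < s₀ ∧ ∀ s, s₀ ≤ s → ∀ n : ℤ,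
      ((n + 1 / 2) * Real.pi + K / s ≤ s * (x₁ - x₀) + θ₀ →
        n * Real.pi + 3 * Real.pi / 4 ≤ Θ (s ^ 2) x₁) ∧
      (s * (x₁ - x₀) + θ₀ ≤ (n + 1 / 2) * Real.pi - K / s →
        Θ (s ^ 2) x₁ ≤ n * Real.pi + Real.pi / 4) := by
  obtain ⟨q, hq⟩ := (isCompact_Icc (a := x₀) (b := x₁)).exists_bound_of_continuousOn
    hQ.continuousOn
  have hq0 : 0 ≤ q := (norm_nonneg _).trans (hq x₀ ⟨le_rfl, hx.le⟩)
  have hl : 0 < x₁ - x₀ := sub_pos.2 hx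
  obtain ⟨K₀, s₁, hK₀⟩ := hβ
  refine ⟨|K₀| + q * (x₁ - x₀) + 2 * (κ + |A|),
    max (max s₁ (2 * (κ + |A|))) (A ^ 2 / (4 * κ) + 1), by positivity,
    lt_max_of_lt_right (by positivity), fun s hs n => ?_⟩
  have hs1 : s₁ ≤ s := (le_max_left _ _).trans ((le_max_left _ _).trans hs)
  have hs2 : 2 * (κ + |A|) ≤ s := (le_max_right _ _).trans ((le_max_left _ _).trans hs)
  have hs3 : A ^ 2 / (4 * κ) + 1 ≤ s := (le_max_right _ _).trans hs
  have hs0 : 0 < s := lt_of_lt_of_le (by positivity) hs2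
  have hs4 : A ^ 2 < 4 * κ * s := by
    have : A ^ 2 / (4 * κ) < s := by linarith
    rwa [div_lt_iff₀ (by positivity), mul_comm] at this
  obtain ⟨ψ₀, hψ₀, hrel₀⟩ := PhaseRel.exists hκ hs4 (β (s ^ 2))
  obtain ⟨θ, hθ, hθ₀⟩ := exists_isPrueferAngle s (-0) (r := fun x => (s ^ 2 - Q x + 0 ^ 2) / s)
    (by fun_prop) hx ψ₀
  have hΘ := h.isPrueferAngle (s ^ 2)
  obtain ⟨φ, dφ, ρ, hφ, e₁⟩ := hΘ.exists_isRealSolution hκ hQ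
  obtain ⟨χ, dχ, σ, hχ, e₂⟩ := hθ.exists_isRealSolution hs0 hQ
  -- the two Prüfer angles stay those of one and the same solution
  have hiff : ∀ x, PhaseRel κ A s (Θ (s ^ 2) x) (θ x) ↔ φ x * dχ x - dφ x * χ x = 0 := by
    intro x
    obtain ⟨hρ, i1, i2⟩ := e₁ x
    obtain ⟨hσ, j1, j2⟩ := e₂ x
    have key : κ * s * (φ x * dχ x - dφ x * χ x) = ρ x * σ x *
        (s * Real.sin (Θ (s ^ 2) x) * Real.cos (θ x) -
          (κ * Real.cos (Θ (s ^ 2) x) - A * Real.sin (Θ (s ^ 2) x)) * Real.sin (θ x)) := by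
      have j2' : dχ x = σ x * Real.cos (θ x) := by linarith
      have i2' : dφ x = ρ x * Real.cos (Θ (s ^ 2) x) - A * φ x := by linarith
      rw [j2', i2']
      linear_combination (s * σ x * Real.cos (θ x) + A * (s * χ x)) * i1 +
        (A * ρ x * Real.sin (Θ (s ^ 2) x) - κ * ρ x * Real.cos (Θ (s ^ 2) x)) * j1
    unfold PhaseRel
    rw [← sub_eq_zero]
    constructor
    · intro h0
      rw [h0, mul_zero] at key
      exact (mul_eq_zero.1 key).resolve_left (by positivity)
    · intro h0
      rw [h0, mul_zero] at key
      exact (mul_eq_zero.1 key.symm).resolve_left (by positivity)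
  have hrel : ∀ x ∈ Icc x₀ x₁, PhaseRel κ A s (Θ (s ^ 2) x) (θ x) := by
    have h0 : PhaseRel κ A s (Θ (s ^ 2) x₀) (θ x₀) := by rwa [h.initial, hθ₀]
    exact fun x hx' => (hiff x).2 (hφ.wronskian_eq_zero hχ ((hiff x₀).1 h0) x hx')
  have hclose : |θ x₁ - Θ (s ^ 2) x₁| < Real.pi / 2 := by
    by_contra! hcon
    have hcont : ContinuousOn (fun x => |θ x - Θ (s ^ 2) x|) (Icc x₀ x₁) :=
      (hθ.continuous.sub hΘ.continuous).abs.continuousOn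
    obtain ⟨x, hx', hx''⟩ := intermediate_value_Icc hx.le hcont
      ⟨by simpa only [h.initial, hθ₀] using hψ₀.le, hcon⟩
    refine (hrel x hx').cos_sub_ne_zero hκ hs4 ?_
    rw [← Real.cos_abs, show |θ x - Θ (s ^ 2) x| = Real.pi / 2 from hx'', Real.cos_pi_div_two]
  have hψ₀' := hK₀ s hs1 ψ₀ hψ₀ hrel₀
  have hturn := hθ.abs_sub_sub_le hs0 hx.le hq
  rw [hθ₀] at hturn
  have hK₀' : K₀ / s ≤ |K₀| / s := by gcongr; exact le_abs_self _
  obtain ⟨a1, a2⟩ := abs_le.1 hψ₀'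
  obtain ⟨b1, b2⟩ := abs_le.1 hturn
  have hrel₁ := hrel x₁ ⟨hx.le, le_rfl⟩
  rw [add_div, add_div]
  constructor
  · intro h1
    exact hrel₁.three_pi_div_four_le hκ hs2 hclose n (by linarith)
  · intro h1
    exact hrel₁.le_pi_div_four hκ hs2 hclose n (by linarith)

/-! ### Merging two increasing sequences -/

/-- Ranks in the merged list: if two increasing unbounded real sequences `u` and `v` are merged
(ties broken in favour of `u`), then `u n` gets the rank `r₁ n = n + #{m | v m < u n}` and `v m`
the rank `r₂ m = m + #{n | u n ≤ v m}`, and each natural number is the rank of exactly one term. -/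
theorem exists_merge_ranks {u v : ℕ → ℝ} (hu : StrictMono u) (hv : StrictMono v)
    (hu' : Tendsto u atTop atTop) (hv' : Tendsto v atTop atTop) :
    ∃ r₁ r₂ : ℕ → ℕ, r₁.Injective ∧ r₂.Injective ∧ (∀ n m, r₁ n ≠ r₂ m) ∧
      (∀ k, (∃ n, r₁ n = k) ∨ ∃ m, r₂ m = k) ∧
      (∀ n, ∃ j, r₁ n = n + j ∧ (∀ m < j, v m ≤ u n) ∧ u n ≤ v j) ∧
      ∀ m, ∃ j, r₂ m = m + j ∧ (∀ n < j, u n ≤ v m) ∧ v m ≤ u j := by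
  have exa : ∀ n, ∃ m, u n ≤ v m := fun n => (hv'.eventually_ge_atTop (u n)).exists
  have exb : ∀ m, ∃ n, v m < u n := fun m => (hu'.eventually_gt_atTop (v m)).exists
  classical
  set a : ℕ → ℕ := fun n => Nat.find (exa n) with ha
  set b : ℕ → ℕ := fun m => Nat.find (exb m) with hb
  have a1 : ∀ n, u n ≤ v (a n) := fun n => Nat.find_spec (exa n)
  have a2 : ∀ n m, m < a n → v m < u n := fun n m h => not_le.1 (Nat.find_min (exa n) h)
  have a3 : ∀ n m, u n ≤ v m → a n ≤ m := fun n m h => Nat.find_min' (exa n) h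
  have b1 : ∀ m, v m < u (b m) := fun m => Nat.find_spec (exb m)
  have b2 : ∀ m n, n < b m → u n ≤ v m := fun m n h => not_lt.1 (Nat.find_min (exb m) h)
  have b3 : ∀ m n, v m < u n → b m ≤ n := fun m n h => Nat.find_min' (exb m) h
  have hlt : ∀ n m, m < a n → b m ≤ n := fun n m h => b3 m n (a2 n m h)
  have hge : ∀ n m, a n ≤ m → n < b m := fun n m h => by
    by_contra! hcon
    exact absurd ((b1 m).trans_le (hu.monotone hcon))
      (not_lt.2 ((a1 n).trans (hv.monotone h)))
  have ham : StrictMono fun n => n + a n := fun n n' h => by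
    have := a3 n (a n') ((hu h).le.trans (a1 n'))
    simp only
    omega
  have hbm : StrictMono fun m => m + b m := fun m m' h => by
    have := b3 m (b m') ((hv h).trans (b1 m'))
    simp only
    omega
  refine ⟨fun n => n + a n, fun m => m + b m, ham.injective, hbm.injective, fun n m h => ?_,
    fun k => ?_, fun n => ⟨a n, rfl, fun m hm => (a2 n m hm).le, a1 n⟩,
    fun m => ⟨b m, rfl, b2 m, (b1 m).le⟩⟩
  · simp only at h
    rcases lt_or_ge m (a n) with h' | h'
    · have := hlt n m h'; omega
    · have := hge n m h'; omega
  · -- the last `n` with `r₁ n ≤ k`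
    have ex : ∃ n, k < n + a n := ⟨k + 1, by omega⟩
    obtain ⟨N, hN, hmin⟩ : ∃ N, k < N + a N ∧ ∀ n < N, ¬ k < n + a n :=
      ⟨Nat.find ex, Nat.find_spec ex, fun n hn => Nat.find_min ex hn⟩
    rcases N with _ | n
    · right
      have := hlt 0 k (by omega)
      exact ⟨k, by change k + b k = k; omega⟩
    · have h1 := hmin n (by omega)
      rcases eq_or_ne (n + a n) k with h2 | h2
      · exact Or.inl ⟨n, h2⟩
      · right
        have h3 := hlt (n + 1) (k - n - 1) (by omega)
        have h4 := hge n (k - n - 1) (by omega)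
        exact ⟨k - n - 1, by change k - n - 1 + b (k - n - 1) = k; omega⟩

/-! ### Sums of two angle functions -/

/-- An increasing continuous function which starts from `0` at `-∞` and, as a function of `s` with
eigenparameter `s ^ 2`, is a smoothed staircase: up to `O(1/s)`, it passes from below
`n π + π / 4` to above `n π + 3 π / 4` when `s ℓ + θ₀` passes `(n + 1/2) π`. -/
structure IsStaircase (G : ℝ → ℝ) (ℓ θ₀ : ℝ) : Prop where
  strictMono : StrictMono G
  continuous : Continuous G
  tendsto_atBot : Tendsto G atBot (𝓝 0)
  phase : ∃ K s₀ : ℝ, 0 < K ∧ 0 < s₀ ∧ ∀ s, s₀ ≤ s → ∀ n : ℤ,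
      ((n + 1 / 2) * Real.pi + K / s ≤ s * ℓ + θ₀ →
        n * Real.pi + 3 * Real.pi / 4 ≤ G (s ^ 2)) ∧
      (s * ℓ + θ₀ ≤ (n + 1 / 2) * Real.pi - K / s → G (s ^ 2) ≤ n * Real.pi + Real.pi / 4)

namespace IsStaircase

variable {G G₁ G₂ : ℝ → ℝ} {ℓ ℓ₁ ℓ₂ θ₀ θ₁ θ₂ : ℝ}

theorem pos (h : IsStaircase G ℓ θ₀) (lam : ℝ) : 0 < G lam :=
  (h.strictMono.monotone.le_of_tendsto h.tendsto_atBot (lam - 1)).trans_lt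
    (h.strictMono (by linarith))

theorem tendsto_atTop (h : IsStaircase G ℓ θ₀) (hℓ : 0 < ℓ) : Tendsto G atTop atTop := by
  obtain ⟨K, s₀, hK, hs₀, hph⟩ := h.phase
  refine tendsto_atTop_atTop_of_monotone h.strictMono.monotone fun b => ?_
  set n := ⌈b / Real.pi⌉ with hn
  have hπ := Real.pi_pos
  have hnb : b ≤ n * Real.pi := (div_le_iff₀ hπ).1 (Int.le_ceil _)
  set s := max s₀ (((n + 1 / 2) * Real.pi + K / s₀ - θ₀) / ℓ) with hs
  have h1 : s₀ ≤ s := le_max_left _ _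
  have h2 : (n + 1 / 2) * Real.pi + K / s₀ - θ₀ ≤ s * ℓ := (div_le_iff₀ hℓ).1 (le_max_right _ _)
  have h3 : K / s ≤ K / s₀ := by gcongr
  exact ⟨s ^ 2, by linarith [(hph s h1 n).1 (by linarith)]⟩

/-- The staircase property with the `O(1/s)` absorbed into a shift of the argument. -/
theorem exists_shift (h : IsStaircase G ℓ θ₀) (hℓ : 0 < ℓ) :
    ∃ K₀ : ℝ, ∀ K, K₀ ≤ K → 0 < K → ∃ s₀ : ℝ, 0 < s₀ ∧ ∀ x, s₀ ≤ x → ∀ n : ℤ,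
      ((n + 1 / 2) * Real.pi ≤ x * ℓ + θ₀ →
        n * Real.pi + 3 * Real.pi / 4 ≤ G ((x + K / x) ^ 2)) ∧
      (x * ℓ + θ₀ ≤ (n + 1 / 2) * Real.pi → G ((x - K / x) ^ 2) ≤ n * Real.pi + Real.pi / 4) ∧
      0 ≤ x - K / x := by
  obtain ⟨K₁, s₁, hK₁, hs₁, hph⟩ := h.phase
  refine ⟨2 * K₁ / ℓ, fun K hK hK0 => ⟨max (2 * s₁) (2 * K + 1), by positivity, fun x hx n => ?_⟩⟩
  have hx1 : 2 * s₁ ≤ x := (le_max_left _ _).trans hx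
  have hx2 : 2 * K + 1 ≤ x := (le_max_right _ _).trans hx
  have hx0 : 0 < x := by linarith
  have hKx : 0 < K / x := by positivity
  rw [div_le_iff₀ hℓ] at hK
  have hKℓ : 2 * K₁ / x ≤ K / x * ℓ := by
    rw [div_mul_eq_mul_div]
    gcongr
  have hhalf : K / x ≤ x / 2 := by
    rw [div_le_iff₀ hx0]
    nlinarith
  refine ⟨fun h1 => ?_, fun h1 => ?_, by linarith⟩
  · refine (hph (x + K / x) (by linarith) n).1 ?_
    have h2 : K₁ / (x + K / x) ≤ 2 * K₁ / x := by
      gcongr <;> linarith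
    linarith
  · refine (hph (x - K / x) (by linarith) n).2 ?_
    have h2 : K₁ / (x - K / x) ≤ 2 * K₁ / x := by
      rw [div_le_div_iff₀ (by linarith) hx0]
      nlinarith
    linarith

/-- The values of the eigenparameter at which the sum of two staircases is an odd multiple of
`π / 2` form one sequence, in which the `k`-th one belongs to the multiple `(k + 1/2) π`. -/
theorem exists_seq (h₁ : IsStaircase G₁ ℓ₁ θ₁) (h₂ : IsStaircase G₂ ℓ₂ θ₂) (hℓ₁ : 0 < ℓ₁) :
    ∃ μ : ℕ → ℝ, μ.Injective ∧ (∀ k : ℕ, G₁ (μ k) + G₂ (μ k) = (k + 1 / 2) * Real.pi) ∧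
      ∀ lam, Real.cos (G₁ lam + G₂ lam) = 0 ↔ ∃ k, μ k = lam := by
  have hπ := Real.pi_pos
  have hF : StrictMono fun lam => G₁ lam + G₂ lam := h₁.strictMono.add h₂.strictMono
  have hlim : Tendsto (fun lam => G₁ lam + G₂ lam) atBot (𝓝 0) := by
    simpa using h₁.tendsto_atBot.add h₂.tendsto_atBot
  have htop : Tendsto (fun lam => G₁ lam + G₂ lam) atTop atTop :=
    tendsto_atTop_mono (fun lam => by linarith [h₂.pos lam]) (h₁.tendsto_atTop hℓ₁)
  have hex : ∀ k : ℕ, ∃ lam, G₁ lam + G₂ lam = (k + 1 / 2) * Real.pi := fun k => by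
    have hk : (0 : ℝ) < (k + 1 / 2) * Real.pi := by positivity
    exact mem_range_of_exists_le_of_exists_ge (h₁.continuous.add h₂.continuous)
      (((hlim.eventually_lt_const hk).exists).imp fun _ => le_of_lt)
      ((htop.eventually_ge_atTop _).exists)
  choose μ hμ using hex
  refine ⟨μ, fun k l hkl => ?_, hμ, fun lam => ⟨fun hc => ?_, ?_⟩⟩
  · have := (hμ k).symm.trans ((congrArg (fun lam => G₁ lam + G₂ lam) hkl).trans (hμ l))
    have := mul_right_cancel₀ hπ.ne' this
    exact_mod_cast add_right_cancel this
  · obtain ⟨j, hj⟩ := Real.cos_eq_zero_iff.1 hc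
    have hpos : 0 < G₁ lam + G₂ lam := add_pos (h₁.pos lam) (h₂.pos lam)
    have hj0 : 0 ≤ j := by
      by_contra! hneg
      have : (j : ℝ) ≤ -1 := by exact_mod_cast Int.le_sub_one_of_lt hneg
      rw [hj] at hpos
      nlinarith
    obtain ⟨k, rfl⟩ := Int.eq_ofNat_of_zero_le hj0
    refine ⟨k, hF.injective ?_⟩
    rw [hμ k, hj]
    push_cast
    ring
  · rintro ⟨k, rfl⟩
    rw [hμ k]
    exact Real.cos_eq_zero_iff.2 ⟨k, by push_cast; ring⟩

/-- The two-sided estimate of the `k`-th value by a point `x` at which the two phases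
`x ℓᵢ + θᵢ` have passed, respectively not passed, suitable half-integers. -/
theorem exists_sqrt_bound (h₁ : IsStaircase G₁ ℓ₁ θ₁) (h₂ : IsStaircase G₂ ℓ₂ θ₂) (hℓ₁ : 0 < ℓ₁)
    (hℓ₂ : 0 < ℓ₂) {μ : ℕ → ℝ}
    (hμ : ∀ k : ℕ, G₁ (μ k) + G₂ (μ k) = (k + 1 / 2) * Real.pi) :
    ∃ K s₀ : ℝ, 0 < K ∧ 0 < s₀ ∧ ∀ x, s₀ ≤ x → ∀ (k : ℕ) (i j : ℤ),
      (i + j + 1 = k → (i + 1 / 2) * Real.pi ≤ x * ℓ₁ + θ₁ →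
        (j + 1 / 2) * Real.pi ≤ x * ℓ₂ + θ₂ → Real.sqrt (μ k) ≤ x + K / x) ∧
      (i + j = k → x * ℓ₁ + θ₁ ≤ (i + 1 / 2) * Real.pi →
        x * ℓ₂ + θ₂ ≤ (j + 1 / 2) * Real.pi → 0 ≤ μ k ∧ x - K / x ≤ Real.sqrt (μ k)) := by
  obtain ⟨K₁, hK₁⟩ := h₁.exists_shift hℓ₁
  obtain ⟨K₂, hK₂⟩ := h₂.exists_shift hℓ₂
  have hF : StrictMono fun lam => G₁ lam + G₂ lam := h₁.strictMono.add h₂.strictMono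
  have hK : 0 < max (max K₁ K₂) 1 := by positivity
  set K := max (max K₁ K₂) 1 with hKdef
  obtain ⟨s₁, hs₁, b₁⟩ := hK₁ K ((le_max_left _ _).trans (le_max_left _ _)) hK
  obtain ⟨s₂, hs₂, b₂⟩ := hK₂ K ((le_max_right _ _).trans (le_max_left _ _)) hK
  refine ⟨K, max s₁ s₂, hK, by positivity, fun x hx k i j => ?_⟩
  have hx1 : s₁ ≤ x := (le_max_left _ _).trans hx
  have hx2 : s₂ ≤ x := (le_max_right _ _).trans hx
  have hx0 : 0 < x := by linarith
  obtain ⟨p1, p2, p3⟩ := b₁ x hx1 i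
  obtain ⟨q1, q2, -⟩ := b₂ x hx2 j
  constructor
  · intro hk hi hj
    have hk' : (i : ℝ) + j + 1 = k := by exact_mod_cast hk
    have e1 := p1 hi
    have e2 := q1 hj
    have : G₁ (μ k) + G₂ (μ k) ≤ G₁ ((x + K / x) ^ 2) + G₂ ((x + K / x) ^ 2) := by
      rw [hμ k, ← hk']
      linarith
    exact (Real.sqrt_le_sqrt (hF.le_iff_le.1 this)).trans_eq (Real.sqrt_sq (by positivity))
  · intro hk hi hj
    have hk' : (i : ℝ) + j = k := by exact_mod_cast hk
    have e1 := p2 hi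
    have e2 := q2 hj
    have : G₁ ((x - K / x) ^ 2) + G₂ ((x - K / x) ^ 2) ≤ G₁ (μ k) + G₂ (μ k) := by
      rw [hμ k, ← hk']
      linarith
    have hle := hF.le_iff_le.1 this
    exact ⟨(sq_nonneg _).trans hle, (Real.sqrt_sq p3).symm.trans_le (Real.sqrt_le_sqrt hle)⟩

end IsStaircase

/-- The point at which the phase `x ℓ + θ` is the half-integer multiple `(n + d + 1/2) π`. -/
noncomputable def modelPoint (ℓ θ : ℝ) (d : ℤ) (n : ℕ) : ℝ :=
  ((n + d + 1 / 2) * Real.pi - θ) / ℓ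

section Model

variable {ℓ : ℝ}

theorem modelPoint_mul_add (hℓ : ℓ ≠ 0) (θ : ℝ) (d : ℤ) (n : ℕ) :
    modelPoint ℓ θ d n * ℓ + θ = (n + d + 1 / 2) * Real.pi := by
  unfold modelPoint
  field_simp
  ring

theorem strictMono_modelPoint (hℓ : 0 < ℓ) (θ : ℝ) (d : ℤ) : StrictMono (modelPoint ℓ θ d) := by
  intro m n h
  have := Real.pi_pos
  have h' : (m : ℝ) < n := by exact_mod_cast h
  unfold modelPoint
  gcongr

theorem eventually_le_modelPoint (hℓ : 0 < ℓ) (θ : ℝ) (d : ℤ) :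
    ∀ᶠ n : ℕ in atTop, Real.pi / (2 * ℓ) * n ≤ modelPoint ℓ θ d n := by
  have hπ := Real.pi_pos
  filter_upwards [(tendsto_natCast_atTop_atTop (R := ℝ)).eventually_ge_atTop
    (2 * (θ - (d + 1 / 2) * Real.pi) / Real.pi)] with n hn
  unfold modelPoint
  rw [div_le_iff₀ hπ] at hn
  rw [le_div_iff₀ hℓ]
  have : Real.pi / (2 * ℓ) * n * ℓ = n * Real.pi / 2 := by field_simp
  rw [this]
  linarith

theorem tendsto_modelPoint (hℓ : 0 < ℓ) (θ : ℝ) (d : ℤ) :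
    Tendsto (modelPoint ℓ θ d) atTop atTop :=
  tendsto_atTop_mono' _ (eventually_le_modelPoint hℓ θ d)
    (tendsto_natCast_atTop_atTop.const_mul_atTop (by positivity))

theorem isBigO_inv_of_le_div_modelPoint (hℓ : 0 < ℓ) {θ K : ℝ} {d : ℤ} (hK : 0 < K) {f : ℕ → ℝ}
    (h : ∀ᶠ n in atTop, |f n| ≤ K / modelPoint ℓ θ d n) :
    f =O[atTop] fun n : ℕ => 1 / (n : ℝ) := by
  have hπ := Real.pi_pos
  refine IsBigO.of_bound (K / (Real.pi / (2 * ℓ))) ?_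
  filter_upwards [h, eventually_le_modelPoint hℓ θ d, eventually_gt_atTop 0] with n h1 h2 h3
  have hn : (0 : ℝ) < n := by exact_mod_cast h3
  rw [Real.norm_eq_abs, Real.norm_of_nonneg (by positivity)]
  refine h1.trans ?_
  calc K / modelPoint ℓ θ d n ≤ K / (Real.pi / (2 * ℓ) * n) := by gcongr
    _ = K / (Real.pi / (2 * ℓ)) * (1 / n) := by field_simp

end Model

/-- The values of the eigenparameter belonging to the sum of two staircases split into two
sequences, whose square roots are asymptotic to the two sequences of model points. Only the total
index matters, so the two numberings may be shifted by opposite amounts `d` and `-d`. -/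
theorem IsStaircase.exists_split {G₁ G₂ : ℝ → ℝ} {ℓ₁ ℓ₂ θ₁ θ₂ : ℝ} (h₁ : IsStaircase G₁ ℓ₁ θ₁)
    (h₂ : IsStaircase G₂ ℓ₂ θ₂) (hℓ₁ : 0 < ℓ₁) (hℓ₂ : 0 < ℓ₂) {μ : ℕ → ℝ}
    (hμ : ∀ k : ℕ, G₁ (μ k) + G₂ (μ k) = (k + 1 / 2) * Real.pi) (d : ℤ) :
    ∃ r₁ r₂ : ℕ → ℕ, r₁.Injective ∧ r₂.Injective ∧ (∀ n m, r₁ n ≠ r₂ m) ∧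
      (∀ k, (∃ n, r₁ n = k) ∨ ∃ m, r₂ m = k) ∧
      ((∀ᶠ n in atTop, 0 ≤ μ (r₁ n)) ∧ (fun n => Real.sqrt (μ (r₁ n)) - modelPoint ℓ₁ θ₁ d n)
        =O[atTop] fun n : ℕ => 1 / (n : ℝ)) ∧
      ((∀ᶠ n in atTop, 0 ≤ μ (r₂ n)) ∧ (fun n => Real.sqrt (μ (r₂ n)) - modelPoint ℓ₂ θ₂ (-d) n)
        =O[atTop] fun n : ℕ => 1 / (n : ℝ)) := by
  obtain ⟨r₁, r₂, i₁, i₂, hdis, hsurj, e₁, e₂⟩ := exists_merge_ranks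
    (strictMono_modelPoint hℓ₁ θ₁ d) (strictMono_modelPoint hℓ₂ θ₂ (-d))
    (tendsto_modelPoint hℓ₁ θ₁ d) (tendsto_modelPoint hℓ₂ θ₂ (-d))
  obtain ⟨K, s₀, hK, hs₀, hb⟩ := h₁.exists_sqrt_bound h₂ hℓ₁ hℓ₂ hμ
  have m₁ := modelPoint_mul_add hℓ₁.ne' θ₁ d
  have m₂ := modelPoint_mul_add hℓ₂.ne' θ₂ (-d)
  have key₁ : ∀ᶠ n in atTop, 0 ≤ μ (r₁ n) ∧
      |Real.sqrt (μ (r₁ n)) - modelPoint ℓ₁ θ₁ d n| ≤ K / modelPoint ℓ₁ θ₁ d n := by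
    filter_upwards [(tendsto_modelPoint hℓ₁ θ₁ d).eventually_ge_atTop s₀,
      (tendsto_modelPoint hℓ₁ θ₁ d).eventually_gt_atTop (modelPoint ℓ₂ θ₂ (-d) 0)] with n h1 h2
    obtain ⟨j, hr, hlow, hup⟩ := e₁ n
    obtain ⟨j', rfl⟩ : ∃ j', j = j' + 1 := Nat.exists_eq_succ_of_ne_zero fun h0 => by
      rw [h0] at hup
      exact absurd h2 (not_lt.2 hup)
    have hA := (hb _ h1 (r₁ n) (n + d) (j' + -d)).1 (by rw [hr]; push_cast; ring)
      (by rw [m₁]; push_cast; exact le_rfl) (by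
        have := mul_le_mul_of_nonneg_right (hlow j' (by omega)) hℓ₂.le
        have := m₂ j'
        push_cast at this ⊢
        linarith)
    have hB := (hb _ h1 (r₁ n) (n + d) ((j' + 1 : ℕ) + -d)).2 (by rw [hr]; push_cast; ring)
      (by rw [m₁]; push_cast; exact le_rfl) (by
        have := mul_le_mul_of_nonneg_right hup hℓ₂.le
        have := m₂ (j' + 1)
        push_cast at this ⊢
        linarith)
    exact ⟨hB.1, abs_le.2 ⟨by linarith [hB.2], by linarith⟩⟩
  have key₂ : ∀ᶠ n in atTop, 0 ≤ μ (r₂ n) ∧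
      |Real.sqrt (μ (r₂ n)) - modelPoint ℓ₂ θ₂ (-d) n| ≤ K / modelPoint ℓ₂ θ₂ (-d) n := by
    filter_upwards [(tendsto_modelPoint hℓ₂ θ₂ (-d)).eventually_ge_atTop s₀,
      (tendsto_modelPoint hℓ₂ θ₂ (-d)).eventually_gt_atTop (modelPoint ℓ₁ θ₁ d 0)] with n h1 h2
    obtain ⟨j, hr, hlow, hup⟩ := e₂ n
    obtain ⟨j', rfl⟩ : ∃ j', j = j' + 1 := Nat.exists_eq_succ_of_ne_zero fun h0 => by
      rw [h0] at hup
      exact absurd h2 (not_lt.2 hup)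
    have hA := (hb _ h1 (r₂ n) (j' + d) (n + -d)).1 (by rw [hr]; push_cast; ring)
      (by
        have := mul_le_mul_of_nonneg_right (hlow j' (by omega)) hℓ₁.le
        have := m₁ j'
        push_cast at this ⊢
        linarith) (by rw [m₂]; push_cast; exact le_rfl)
    have hB := (hb _ h1 (r₂ n) ((j' + 1 : ℕ) + d) (n + -d)).2 (by rw [hr]; push_cast; ring)
      (by
        have := mul_le_mul_of_nonneg_right hup hℓ₁.le
        have := m₁ (j' + 1)
        push_cast at this ⊢
        linarith) (by rw [m₂]; push_cast; exact le_rfl)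
    exact ⟨hB.1, abs_le.2 ⟨by linarith [hB.2], by linarith⟩⟩
  exact ⟨r₁, r₂, i₁, i₂, hdis, hsurj,
    ⟨key₁.mono fun _ h => h.1, isBigO_inv_of_le_div_modelPoint hℓ₁ hK (key₁.mono fun _ h => h.2)⟩,
    ⟨key₂.mono fun _ h => h.1, isBigO_inv_of_le_div_modelPoint hℓ₂ hK (key₂.mono fun _ h => h.2)⟩⟩

/-! ### Initial angles -/

/-- Polar coordinates with the angle in `[0, π)` and a radius of either sign. -/
theorem exists_direction (w u : ℝ) :
    ∃ β R : ℝ, 0 ≤ β ∧ β < Real.pi ∧ w = R * Real.cos β ∧ u = R * Real.sin β ∧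
      (u = 0 → β = 0) ∧ (u ≠ 0 → 0 < β) := by
  have hπ := Real.pi_pos
  by_cases hu : u = 0
  · exact ⟨0, w, le_rfl, hπ, by simp, by simp [hu], fun _ => rfl, fun h' => absurd hu h'⟩
  · have h1 := Real.neg_pi_div_two_lt_arctan (w / u)
    have h2 := Real.arctan_lt_pi_div_two (w / u)
    have hc := Real.cos_arctan_pos (w / u)
    have ht : Real.sin (Real.arctan (w / u)) = w / u * Real.cos (Real.arctan (w / u)) := by
      have := Real.tan_arctan (w / u)
      rwa [Real.tan_eq_sin_div_cos, div_eq_iff hc.ne'] at this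
    refine ⟨Real.pi / 2 - Real.arctan (w / u), u / Real.cos (Real.arctan (w / u)), by linarith,
      by linarith, ?_, ?_, fun h' => absurd h' hu, fun _ => by linarith⟩
    · rw [Real.cos_pi_div_two_sub, ht]
      field_simp
    · rw [Real.sin_pi_div_two_sub]
      field_simp

theorem IsAngleFamily.isStaircase {κ A x₀ x₁ θ₀ δ : ℝ} {Q β : ℝ → ℝ} {Θ : ℝ → ℝ → ℝ}
    (h : IsAngleFamily κ A Q x₀ x₁ β Θ) (hκ : 0 < κ) (hQ : Continuous Q) (hx : x₀ < x₁)
    (hβ : Monotone β) (hβc : Continuous β) (hβ0 : ∀ lam, 0 ≤ β lam) (hδ : 0 < δ)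
    (hβδ : ∀ᶠ lam in atBot, β lam ≤ Real.pi - δ) (hph : HasInitialPhase κ A β θ₀) :
    IsStaircase (fun lam => Θ lam x₁) (x₁ - x₀) θ₀ :=
  ⟨h.strictMono hκ hQ hx hβ, h.continuous hκ hQ hx hβ hβc, h.tendsto_atBot hκ hQ hx hβ0 hδ hβδ,
    h.exists_phase_bound hκ hQ hx hph⟩

/-- The direction of the vector `(w₀ + lam w₁, u₀ + lam u₁)` turns monotonically by `π`, from the
direction `β∞ ∈ [0, π)` of `(w₁, u₁)` at `lam = -∞` to `β∞ + π` at `lam = +∞`, if the determinant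
`w₀ u₁ - u₀ w₁` is positive. -/
theorem exists_rotating_direction {w₀ w₁ u₀ u₁ : ℝ} (h : 0 < w₀ * u₁ - u₀ * w₁) :
    ∃ βinf t₀ d : ℝ, 0 < d ∧ 0 ≤ βinf ∧ βinf < Real.pi ∧ (u₁ = 0 → βinf = 0) ∧
      (u₁ ≠ 0 → 0 < βinf) ∧ ∀ lam, (u₀ + lam * u₁) *
          Real.cos (βinf + (Real.pi / 2 + Real.arctan ((lam + t₀) / d))) =
        (w₀ + lam * w₁) * Real.sin (βinf + (Real.pi / 2 + Real.arctan ((lam + t₀) / d))) := by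
  have hne : w₁ ≠ 0 ∨ u₁ ≠ 0 := by
    by_contra! hcon
    rw [hcon.1, hcon.2] at h
    simp at h
  obtain ⟨β, R, hβ0, hβπ, hw, hu, hz, hnz⟩ := exists_direction w₁ u₁
  have hN : 0 < w₁ ^ 2 + u₁ ^ 2 := by
    rcases hne with h' | h' <;> positivity
  -- `(w₀ + i u₀) / (w₁ + i u₁) = t₀ - i d`
  refine ⟨β, (w₀ * w₁ + u₀ * u₁) / (w₁ ^ 2 + u₁ ^ 2),
    (w₀ * u₁ - u₀ * w₁) / (w₁ ^ 2 + u₁ ^ 2), div_pos h hN, hβ0, hβπ, hz, hnz, fun lam => ?_⟩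
  have hd : 0 < (w₀ * u₁ - u₀ * w₁) / (w₁ ^ 2 + u₁ ^ 2) := div_pos h hN
  have e1 : w₀ = (w₀ * w₁ + u₀ * u₁) / (w₁ ^ 2 + u₁ ^ 2) * w₁ +
      (w₀ * u₁ - u₀ * w₁) / (w₁ ^ 2 + u₁ ^ 2) * u₁ := by field_simp; ring
  have e2 : u₀ = (w₀ * w₁ + u₀ * u₁) / (w₁ ^ 2 + u₁ ^ 2) * u₁ -
      (w₀ * u₁ - u₀ * w₁) / (w₁ ^ 2 + u₁ ^ 2) * w₁ := by field_simp; ring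
  set d := (w₀ * u₁ - u₀ * w₁) / (w₁ ^ 2 + u₁ ^ 2)
  set t₀ := (w₀ * w₁ + u₀ * u₁) / (w₁ ^ 2 + u₁ ^ 2)
  have htd : (lam + t₀) / d * d = lam + t₀ := div_mul_cancel₀ _ hd.ne'
  set t := (lam + t₀) / d
  have hts : Real.sin (Real.arctan t) = t * Real.cos (Real.arctan t) := by
    have := Real.tan_arctan t
    rwa [Real.tan_eq_sin_div_cos, div_eq_iff (Real.cos_arctan_pos t).ne'] at this
  have f1 : w₀ + lam * w₁ = d * (t * w₁ + u₁) := by linear_combination e1 - w₁ * htd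
  have f2 : u₀ + lam * u₁ = d * (t * u₁ - w₁) := by linear_combination e2 - u₁ * htd
  rw [f1, f2, Real.sin_add, Real.cos_add, add_comm (Real.pi / 2), Real.sin_add_pi_div_two,
    Real.cos_add_pi_div_two, hts, hw, hu]
  ring

namespace TransmissionProblem

variable {P : TransmissionProblem}

/-- For real `lam`, the eigenvalue condition is `cos (G₁ lam + G₂ lam) = 0`, where `G₁` and `G₂`
are the Prüfer angles at the transmission point of the solutions that satisfy the boundary
condition at `b` and at `a`, respectively. -/
theorem exists_staircases (hac : P.a < P.c) (hcb : P.c < P.b) (hα : P.α₁₀ ≠ 0 ∨ P.α₁₁ ≠ 0)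
    (hΔ₀ : 0 < P.Δ₀) (hΔ₁₂ : 0 < P.Δ₁₂) (hΔ₃₄ : 0 < P.Δ₃₄) (hΔ₂₄ : P.Δ₂₄ ≠ 0)
    {Q₁ Q₂ : ℝ → ℝ} (hQ₁c : Continuous Q₁) (hQ₂c : Continuous Q₂)
    (hQ₁ : ∀ x ∈ Ico P.a P.c, Q₁ x = P.q x) (hQ₂ : ∀ x ∈ Ico (-P.b) (-P.c), Q₂ x = P.q (-x)) :
    ∃ G₁ G₂ : ℝ → ℝ,
      IsStaircase G₁ (P.b - P.c) (if P.α'₂₁ = 0 then Real.pi else 3 * Real.pi / 2) ∧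
      IsStaircase G₂ (P.c - P.a) (if P.α₁₁ = 0 then 0 else Real.pi / 2) ∧
      ∀ lam : ℝ, P.IsEigenvalue lam ↔ Real.cos (G₁ lam + G₂ lam) = 0 := by
  have hπ := Real.pi_pos
  have hκ := kappa_pos hΔ₁₂ hΔ₃₄ hΔ₂₄
  have hbc : -P.b < -P.c := neg_lt_neg hcb
  obtain ⟨β, R, hβ0, hβπ, hw, hu, hz, hnz⟩ :=
    exists_direction (-P.α₁₀ + P.shearLeft * P.α₁₁) (P.kappa * P.α₁₁)
  obtain ⟨Θ₁, hΘ₁⟩ := exists_isAngleFamily P.kappa P.shearLeft hQ₁c hac fun _ => β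
  have hS₁ : IsStaircase (fun lam => Θ₁ lam P.c) (P.c - P.a)
      (if P.α₁₁ = 0 then 0 else Real.pi / 2) := by
    refine hΘ₁.isStaircase hκ hQ₁c hac monotone_const continuous_const (fun _ => hβ0)
      (sub_pos.2 hβπ) (.of_forall fun _ => by linarith) ?_
    split_ifs with h
    · rw [hz (by rw [h, mul_zero])]
      exact hasInitialPhase_zero hκ _
    · have hβ0' := hnz (mul_ne_zero hκ.ne' h)
      have := hasInitialPhase_of_mem hκ P.shearLeft (β := fun _ => β)
        (η := min β (Real.pi - β)) (lt_min hβ0' (sub_pos.2 hβπ)) 0 (.of_forall fun _ => by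
          have := min_le_left β (Real.pi - β)
          have := min_le_right β (Real.pi - β)
          push_cast
          constructor <;> linarith)
      simpa using this
  obtain ⟨βinf, t₀, d, hd, hinf0, hinfπ, hinfz, hinfnz, hrot⟩ := exists_rotating_direction
    (w₀ := -P.α₂₀ + P.shearRight * P.α₂₁) (w₁ := -P.α'₂₀ + P.shearRight * P.α'₂₁)
    (u₀ := P.kappa * P.α₂₁) (u₁ := P.kappa * P.α'₂₁) (by
      have : (-P.α₂₀ + P.shearRight * P.α₂₁) * (P.kappa * P.α'₂₁) -
          P.kappa * P.α₂₁ * (-P.α'₂₀ + P.shearRight * P.α'₂₁) = P.kappa * P.Δ₀ := by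
        rw [Δ₀_eq]; ring
      rw [this]
      exact mul_pos hκ hΔ₀)
  set β₂ : ℝ → ℝ := fun lam => βinf + (Real.pi / 2 + Real.arctan ((lam + t₀) / d)) with hβ₂
  have harg_top : Tendsto (fun lam : ℝ => (lam + t₀) / d) atTop atTop :=
    (tendsto_atTop_add_const_right _ _ tendsto_id).atTop_div_const hd
  have harg_bot : Tendsto (fun lam : ℝ => (lam + t₀) / d) atBot atBot :=
    (tendsto_atBot_add_const_right _ _ tendsto_id).atBot_div_const hd
  obtain ⟨Θ₂, hΘ₂⟩ := exists_isAngleFamily P.kappa P.shearRight hQ₂c hbc β₂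
  have hS₂ : IsStaircase (fun lam => Θ₂ lam (-P.c)) (P.b - P.c)
      (if P.α'₂₁ = 0 then Real.pi else 3 * Real.pi / 2) := by
    rw [show P.b - P.c = -P.c - -P.b by ring]
    have hlow : ∀ᶠ lam in atBot, β₂ lam ≤ Real.pi - (Real.pi - βinf) / 2 := by
      have := (Real.tendsto_arctan_atBot.mono_right nhdsWithin_le_nhds).comp harg_bot
      filter_upwards [this.eventually_lt_const
        (show -(Real.pi / 2) < -(Real.pi / 2) + (Real.pi - βinf) / 2 by linarith)] with lam hl
      simp only [Function.comp] at hl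
      simp only [hβ₂]
      linarith
    refine hΘ₂.isStaircase hκ hQ₂c hbc (fun x y hxy => ?_) ?_ (fun lam => ?_)
      (half_pos (sub_pos.2 hinfπ)) hlow ?_
    · simp only [hβ₂]
      gcongr
    · have := Real.continuous_arctan
      simp only [hβ₂]
      fun_prop
    · have := Real.neg_pi_div_two_lt_arctan ((lam + t₀) / d)
      simp only [hβ₂]
      linarith
    · split_ifs with h
      · simp only [hβ₂, hinfz (by rw [h, mul_zero]), zero_add]
        exact hasInitialPhase_arctan hκ _ t₀ hd
      · have hinf0' := hinfnz (mul_ne_zero hκ.ne' h)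
        have := hasInitialPhase_of_mem hκ P.shearRight (β := β₂)
          (η := min (βinf / 2) (Real.pi - βinf)) (lt_min (half_pos hinf0') (sub_pos.2 hinfπ)) 1 (by
            have := (Real.tendsto_arctan_atTop.mono_right nhdsWithin_le_nhds).comp harg_top
            filter_upwards [this.eventually_const_lt
              (show Real.pi / 2 - βinf / 2 < Real.pi / 2 by linarith)] with lam hl
            have := min_le_left (βinf / 2) (Real.pi - βinf)
            have := min_le_right (βinf / 2) (Real.pi - βinf)
            have := Real.arctan_lt_pi_div_two ((lam + t₀) / d)
            simp only [Function.comp] at hl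
            simp only [hβ₂]
            push_cast
            constructor <;> linarith)
        rwa [show ((1 : ℤ) : ℝ) * Real.pi + Real.pi / 2 = 3 * Real.pi / 2 by push_cast; ring]
          at this
  refine ⟨_, _, hS₂, hS₁, fun lam => ?_⟩
  rw [isEigenvalue_iff_cos_eq_zero hac hcb hα hΔ₀ hΔ₁₂ hΔ₃₄ hΔ₂₄ hQ₁c hQ₂c hQ₁ hQ₂
    (hΘ₁.isPrueferAngle lam) (hΘ₂.isPrueferAngle lam) ?_ ?_, add_comm]
  · rw [hΘ₁.initial, hw, hu]
    ring
  · rw [hΘ₂.initial]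
    linear_combination hrot lam

/-! ### Listing the eigenvalues -/

theorem asymptoticTo_of_sqrt {s : ℕ → ℂ} {μ t : ℕ → ℝ} (h0 : ∀ᶠ n in atTop, 0 ≤ μ n)
    (hs : ∀ n, 0 ≤ μ n → s n = Real.sqrt (μ n))
    (h : (fun n => Real.sqrt (μ n) - t n) =O[atTop] fun n : ℕ => 1 / (n : ℝ)) :
    AsymptoticTo s t := by
  refine IsBigO.congr' (f₁ := fun n => ((Real.sqrt (μ n) - t n : ℝ) : ℂ)) ?_ ?_ .rfl
  · exact Complex.isBigO_ofReal_left.2 h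
  · filter_upwards [h0] with n hn
    rw [hs n hn]
    push_cast
    rfl

theorem AsymptoticTo.neg {s : ℕ → ℂ} {t : ℕ → ℝ} (h : AsymptoticTo s t) :
    AsymptoticTo (fun n => -s n) (fun n => -t n) := by
  refine (IsBigO.neg_left h).congr_left fun n => ?_
  push_cast
  ring

theorem AsymptoticTo.pred {s : ℕ → ℂ} {t : ℕ → ℝ} (h : AsymptoticTo s t) :
    AsymptoticTo (fun n => s (n - 1)) (fun n => t (n - 1)) := by
  refine (h.comp_tendsto (tendsto_sub_atTop_nat 1)).trans (IsBigO.of_bound 2 ?_)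
  filter_upwards [eventually_ge_atTop 2] with n hn
  have h2 : (2 : ℝ) ≤ n := by exact_mod_cast hn
  have e : ((n - 1 : ℕ) : ℝ) = n - 1 := by push_cast [Nat.cast_sub (by omega : 1 ≤ n)]; ring
  simp only [Function.comp]
  rw [e, Real.norm_of_nonneg (by apply div_nonneg <;> linarith),
    Real.norm_of_nonneg (by positivity), mul_one_div, div_le_div_iff₀ (by linarith) (by linarith)]
  linarith

theorem AsymptoticTo.congr_eventually {s : ℕ → ℂ} {t t' : ℕ → ℝ} (h : AsymptoticTo s t)
    (ht : ∀ᶠ n in atTop, t n = t' n) : AsymptoticTo s t' := by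
  refine IsBigO.congr' h ?_ .rfl
  filter_upwards [ht] with n hn
  rw [hn]

theorem EigenvaluesListedBy.pred {s₁ s₂ : ℕ → ℂ} (h : P.EigenvaluesListedBy 0 0 s₁ s₂) :
    P.EigenvaluesListedBy 1 0 (fun n => s₁ (n - 1)) s₂ := by
  have e : (fun n => s₁ (n - 1) ^ 2) '' Ici 1 = (fun n => s₁ n ^ 2) '' Ici 0 := by
    ext z
    constructor
    · rintro ⟨n, -, rfl⟩
      exact ⟨n - 1, Nat.zero_le _, rfl⟩
    · rintro ⟨n, -, rfl⟩
      exact ⟨n + 1, by simp, by simp⟩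
  obtain ⟨h1, h2, h3, h4⟩ := h
  refine ⟨by rw [e]; exact h1, fun m hm n hn hmn => ?_, h3, by rw [e]; exact h4⟩
  have := h2 (Nat.zero_le (m - 1)) (Nat.zero_le (n - 1)) hmn
  have hm' : 1 ≤ m := hm
  have hn' : 1 ≤ n := hn
  omega

/-- A square root of the real number `x` in `ℂ`, equal to the real square root if `0 ≤ x`. -/
noncomputable def complexSqrt (x : ℝ) : ℂ := (x : ℂ) ^ (1 / 2 : ℂ)

theorem complexSqrt_sq (x : ℝ) : complexSqrt x ^ 2 = x := by
  rw [complexSqrt, one_div]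
  exact_mod_cast Complex.cpow_nat_inv_pow (x : ℂ) two_ne_zero

theorem complexSqrt_of_nonneg {x : ℝ} (h : 0 ≤ x) : complexSqrt x = Real.sqrt x := by
  rw [complexSqrt, Real.sqrt_eq_rpow, Complex.ofReal_cpow h]
  norm_num

/-- The `k`-th eigenvalue goes to the sequence that `IsStaircase.exists_split` assigns it to; the
square roots are taken with opposite signs in the two sequences. -/
theorem exists_listing {G₁ G₂ : ℝ → ℝ} {ℓ₁ ℓ₂ θ₁ θ₂ : ℝ} (h₁ : IsStaircase G₁ ℓ₁ θ₁)
    (h₂ : IsStaircase G₂ ℓ₂ θ₂) (hℓ₁ : 0 < ℓ₁) (hℓ₂ : 0 < ℓ₂) {μ : ℕ → ℝ} (hinj : μ.Injective)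
    (hμ : ∀ k : ℕ, G₁ (μ k) + G₂ (μ k) = (k + 1 / 2) * Real.pi)
    (hset : {mu : ℂ | P.IsEigenvalue mu} = range fun k => (μ k : ℂ)) (d : ℤ) :
    ∃ s₁ s₂ : ℕ → ℂ, P.EigenvaluesListedBy 0 0 s₁ s₂ ∧
      AsymptoticTo s₁ (modelPoint ℓ₁ θ₁ d) ∧
      AsymptoticTo s₂ (fun n => -modelPoint ℓ₂ θ₂ (-d) n) := by
  obtain ⟨r₁, r₂, i₁, i₂, hdis, hsurj, ⟨p₁, a₁⟩, ⟨p₂, a₂⟩⟩ := h₁.exists_split h₂ hℓ₁ hℓ₂ hμ d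
  have hinj' : Function.Injective fun k => (μ k : ℂ) := Complex.ofReal_injective.comp hinj
  refine ⟨fun n => complexSqrt (μ (r₁ n)), fun n => -complexSqrt (μ (r₂ n)), ?_,
    asymptoticTo_of_sqrt p₁ (fun n hn => complexSqrt_of_nonneg hn) a₁,
    (asymptoticTo_of_sqrt p₂ (fun n hn => complexSqrt_of_nonneg hn) a₂).neg⟩
  unfold EigenvaluesListedBy
  simp only [neg_sq, complexSqrt_sq]
  refine ⟨?_, (hinj'.comp i₁).injOn, (hinj'.comp i₂).injOn, ?_⟩
  · rw [hset]
    ext z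
    constructor
    · rintro ⟨k, rfl⟩
      rcases hsurj k with ⟨n, rfl⟩ | ⟨n, rfl⟩
      · exact Or.inl ⟨n, Nat.zero_le n, rfl⟩
      · exact Or.inr ⟨n, Nat.zero_le n, rfl⟩
    · rintro (⟨n, -, rfl⟩ | ⟨n, -, rfl⟩)
      · exact ⟨r₁ n, rfl⟩
      · exact ⟨r₂ n, rfl⟩
  · rw [Set.disjoint_left]
    rintro z ⟨n, -, rfl⟩ ⟨m, -, h⟩
    exact hdis n m (hinj' h).symm

end TransmissionProblem

theorem mainTheorem5 (P : TransmissionProblem)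
    (hac : P.a < P.c) (hcb : P.c < P.b) (hq : P.PotentialRegular)
    (hα : P.α₁₀ ≠ 0 ∨ P.α₁₁ ≠ 0)
    (hΔ₀ : 0 < P.Δ₀) (hΔ₁₂ : 0 < P.Δ₁₂) (hΔ₃₄ : 0 < P.Δ₃₄) (hΔ₂₄ : P.Δ₂₄ ≠ 0) :
    (∀ mu : ℂ, P.IsEigenvalue mu → mu.im = 0) ∧
    {mu : ℂ | P.IsEigenvalue mu}.Countable ∧
    {mu : ℂ | P.IsEigenvalue mu}.Infinite ∧
    (P.α'₂₁ ≠ 0 → P.α₁₁ ≠ 0 → ∃ s₁ s₂ : ℕ → ℂ, P.EigenvaluesListedBy 1 0 s₁ s₂ ∧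
      TransmissionProblem.AsymptoticTo s₁
        (fun n => ((n : ℝ) - 2) * Real.pi / (P.b - P.c)) ∧
      TransmissionProblem.AsymptoticTo s₂
        (fun n => (n : ℝ) * Real.pi / (P.a - P.c))) ∧
    (P.α'₂₁ ≠ 0 → P.α₁₁ = 0 → ∃ s₁ s₂ : ℕ → ℂ, P.EigenvaluesListedBy 0 0 s₁ s₂ ∧
      TransmissionProblem.AsymptoticTo s₁
        (fun n => ((n : ℝ) - 1) * Real.pi / (P.b - P.c)) ∧
      TransmissionProblem.AsymptoticTo s₂
        (fun n => ((n : ℝ) + 1 / 2) * Real.pi / (P.a - P.c))) ∧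
    (P.α'₂₁ = 0 → P.α₁₁ ≠ 0 → ∃ s₁ s₂ : ℕ → ℂ, P.EigenvaluesListedBy 0 0 s₁ s₂ ∧
      TransmissionProblem.AsymptoticTo s₁
        (fun n => ((n : ℝ) + 1 / 2) * Real.pi / (P.b - P.c)) ∧
      TransmissionProblem.AsymptoticTo s₂
        (fun n => ((n : ℝ) - 1) * Real.pi / (P.a - P.c))) ∧
    (P.α'₂₁ = 0 → P.α₁₁ = 0 → ∃ s₁ s₂ : ℕ → ℂ, P.EigenvaluesListedBy 0 0 s₁ s₂ ∧
      TransmissionProblem.AsymptoticTo s₁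
        (fun n => ((n : ℝ) - 1 / 2) * Real.pi / (P.b - P.c)) ∧
      TransmissionProblem.AsymptoticTo s₂
        (fun n => ((n : ℝ) + 1 / 2) * Real.pi / (P.a - P.c))) := by

  obtain ⟨hq1, hq2, ⟨l, hl⟩, ⟨r, hr⟩⟩ := hq
  have hbc : -P.b < -P.c := neg_lt_neg hcb
  obtain ⟨Q₁, hQ₁c, hQ₁⟩ := exists_continuous_eqOn_Ico hac hq1 hl
  obtain ⟨Q₂, hQ₂c, hQ₂⟩ := exists_continuous_eqOn_Ico (q := fun x => P.q (-x)) hbc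
    (hq2.comp continuous_neg.continuousOn
      fun x hx => ⟨by linarith [hx.2], by linarith [hx.1]⟩)
    (hr.comp (TransmissionProblem.tendsto_neg_nhdsLT_neg P.c))
  have hreal : ∀ mu : ℂ, P.IsEigenvalue mu → mu.im = 0 := fun mu h => by
    obtain ⟨y, dy, z, dz, ym, dym, zm, dzm, hp, hne⟩ := h.exists_isHalfPair hQ₁ hQ₂
    exact hp.im_eq_zero hac hcb hα hΔ₀ hΔ₁₂ hΔ₃₄ hne
  obtain ⟨G₁, G₂, h₁, h₂, hiff⟩ :=
    TransmissionProblem.exists_staircases hac hcb hα hΔ₀ hΔ₁₂ hΔ₃₄ hΔ₂₄ hQ₁c hQ₂c hQ₁ hQ₂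
  have hℓ₁ : 0 < P.b - P.c := sub_pos.2 hcb
  have hℓ₂ : 0 < P.c - P.a := sub_pos.2 hac
  have hneg : P.a - P.c = -(P.c - P.a) := by ring
  obtain ⟨μ, hinj, hμ, hcos⟩ := h₁.exists_seq h₂ hℓ₁
  have hset : {mu : ℂ | P.IsEigenvalue mu} = range fun k => (μ k : ℂ) := by
    ext mu
    constructor
    · intro h
      have e : mu = (mu.re : ℂ) := Complex.ext rfl (by simpa using hreal mu h)
      rw [e] at h ⊢
      obtain ⟨k, hk⟩ := (hcos _).1 ((hiff _).1 h)
      exact ⟨k, by simp only [hk]⟩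
    · rintro ⟨k, rfl⟩
      exact (hiff _).2 ((hcos _).2 ⟨k, rfl⟩)
  have hlist := TransmissionProblem.exists_listing h₁ h₂ hℓ₁ hℓ₂ hinj hμ hset
  refine ⟨hreal, ?_, ?_, fun hα' hα₁ => ?_, fun hα' hα₁ => ?_, fun hα' hα₁ => ?_,
    fun hα' hα₁ => ?_⟩
  · rw [hset]
    exact countable_range _
  · rw [hset]
    exact infinite_range_of_injective (Complex.ofReal_injective.comp hinj)
  · obtain ⟨s₁, s₂, hs, a₁, a₂⟩ := hlist 0
    refine ⟨_, s₂, hs.pred, a₁.pred.congr_eventually ?_, a₂.congr_eventually (.of_forall ?_)⟩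
    · filter_upwards [eventually_ge_atTop 1] with n hn
      simp only [modelPoint, if_neg hα', Nat.cast_sub hn]
      push_cast
      ring
    · intro n
      simp only [modelPoint, if_neg hα₁, hneg]
      push_cast
      field_simp
      ring
  · obtain ⟨s₁, s₂, hs, a₁, a₂⟩ := hlist 0
    refine ⟨s₁, s₂, hs, a₁.congr_eventually (.of_forall fun n => ?_),
      a₂.congr_eventually (.of_forall fun n => ?_)⟩
    · simp only [modelPoint, if_neg hα']
      push_cast
      ring
    · simp only [modelPoint, if_pos hα₁, hneg]
      push_cast
      field_simp
      ring
  · -- the claimed numbering moves one index from the first sequence to the second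
    obtain ⟨s₁, s₂, hs, a₁, a₂⟩ := hlist 1
    refine ⟨s₁, s₂, hs, a₁.congr_eventually (.of_forall fun n => ?_),
      a₂.congr_eventually (.of_forall fun n => ?_)⟩
    · simp only [modelPoint, if_pos hα']
      push_cast
      ring
    · simp only [modelPoint, if_neg hα₁, hneg]
      push_cast
      field_simp
      ring
  · obtain ⟨s₁, s₂, hs, a₁, a₂⟩ := hlist 0
    refine ⟨s₁, s₂, hs, a₁.congr_eventually (.of_forall fun n => ?_),
      a₂.congr_eventually (.of_forall fun n => ?_)⟩
    · simp only [modelPoint, if_pos hα']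
      push_cast
      ring
    · simp only [modelPoint, if_pos hα₁, hneg]
      push_cast
      field_simp
      ring
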